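/- Theorem 1. For $\theta\in\mathbb R$ let $R_x^{\theta},R_y^{\theta}\in SO(3)$ be the rotations by the angle $\theta$ about the $x$-axis and the $y$-axis. For a positive integer $m$ let $\hat G(m,4)\subset SO(3)$ be the subgroup generated by $T=R_x^{2\pi/m}$ and $S=R_y^{\pi/2}$. Let $D_n$ denote the dihedral group of order $2n$, and let $\langle\alpha,\beta: r_1,r_2,\dots\rangle$ denote the group with generators $\alpha,\beta$ and relators $r_1,r_2,\dots$. An equality of $\hat G(m,4)$ with such a group means that $\alpha\mapsto T$, $\beta\mapsto S$ defines an isomorphism onto $\hat G(m,4)$. 1. If $m$ is odd, then $$\hat G(m,4)=\langle\alpha,\beta:\alpha^m,\beta^4,(\alpha\beta^2)^2\rangle=D_m*_{\mathbb Z_2}\mathbb Z_4,$$ where $D_m$ is generated by $\alpha$ and $\beta^2$, $\mathbb Z_4$ is generated by $\beta$, and the amalgamated $\mathbb Z_2$ is $\{1,\beta^2\}$. 2. If $m$ is twice an odd number, then $$\hat G(m,4)=\langle\alpha,\beta:\alpha^m,\beta^4,(\alpha\beta^2)^2,(\alpha^{m/2}\beta)^2\rangle=D_m*_{D_2}D_4,$$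 where $D_m$ is generated by $\alpha$ and $\beta^2$, $D_4$ is generated by $\alpha^{m/2}$ and $\beta$, and the amalgamated $D_2$ is generated by $\alpha^{m/2}$ and $\beta^2$. 3. If $m$ is divisible by $4$, then $$\hat G(m,4)=\langle\alpha,\beta:\alpha^m,\beta^4,(\alpha\beta^2)^2,(\alpha^{m/2}\beta)^2,(\alpha^{m/4}\beta)^3\rangle=D_m*_{D_4}\hat G(4,4),$$ where $D_m$ is generated by $\alpha$ and $\beta^2$, $\hat G(4,4)$ is generated by $\alpha^{m/4}$ and $\beta$, and the amalgamated $D_4$ is generated by $\alpha^{m/4}$ and $\beta^2$. -/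

import Mathlib

open Real

/-- The rotation group `SO(3)`: orthogonal real 3 by 3 matrices of determinant one. -/
abbrev SO3 : Type := Matrix.specialOrthogonalGroup (Fin 3) ℝ

/-- The matrix of the rotation by the angle `θ` about the `x`-axis. -/
noncomputable def rotMatX (θ : ℝ) : Matrix (Fin 3) (Fin 3) ℝ :=
  !![1, 0, 0; 0, cos θ, -sin θ; 0, sin θ, cos θ]

/-- The matrix of the rotation by the angle `θ` about the `y`-axis. -/
noncomputable def rotMatY (θ : ℝ) : Matrix (Fin 3) (Fin 3) ℝ :=
  !![cos θ, 0, sin θ; 0, 1, 0; -sin θ, 0, cos θ]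

theorem rotMatX_mem (θ : ℝ) : rotMatX θ ∈ Matrix.specialOrthogonalGroup (Fin 3) ℝ := by
  have h := Real.sin_sq_add_cos_sq θ
  rw [Matrix.mem_specialOrthogonalGroup_iff, Matrix.mem_orthogonalGroup_iff]
  refine ⟨?_, ?_⟩
  · ext i j
    fin_cases i <;> fin_cases j <;>
      simp [rotMatX, Matrix.mul_apply, Fin.sum_univ_three] <;> linarith
  · simp [rotMatX, Matrix.det_fin_three]
    linarith

theorem rotMatY_mem (θ : ℝ) : rotMatY θ ∈ Matrix.specialOrthogonalGroup (Fin 3) ℝ := by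
  have h := Real.sin_sq_add_cos_sq θ
  rw [Matrix.mem_specialOrthogonalGroup_iff, Matrix.mem_orthogonalGroup_iff]
  refine ⟨?_, ?_⟩
  · ext i j
    fin_cases i <;> fin_cases j <;>
      simp [rotMatY, Matrix.mul_apply, Fin.sum_univ_three] <;> linarith
  · simp [rotMatY, Matrix.det_fin_three]
    linarith

/-- `R_x^θ`, the rotation by the angle `θ` about the `x`-axis. -/
noncomputable def Rx (θ : ℝ) : SO3 := ⟨rotMatX θ, rotMatX_mem θ⟩

/-- `R_y^θ`, the rotation by the angle `θ` about the `y`-axis. -/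
noncomputable def Ry (θ : ℝ) : SO3 := ⟨rotMatY θ, rotMatY_mem θ⟩

/-- The subgroup of `SO(3)` generated by `R_x^{2π/p}` and `R_y^{2π/q}`. -/
noncomputable def Ghat (p q : ℕ) : Subgroup SO3 :=
  Subgroup.closure {Rx (2 * π / p), Ry (2 * π / q)}

namespace Amalgam

/-- The two-member family consisting of `A` and `B`. -/
def Fam (A B : Type) : Bool → Type
  | false => A
  | true => B

instance (A B : Type) [Group A] [Group B] : ∀ b, Group (Fam A B b)
  | false => inferInstanceAs (Group A)
  | true => inferInstanceAs (Group B)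

/-- The two homomorphisms `i : H →* A` and `j : H →* B` as a family. -/
def famHom {H A B : Type} [Group H] [Group A] [Group B] (i : H →* A) (j : H →* B) :
    ∀ b, H →* Fam A B b
  | false => i
  | true => j

end Amalgam

/-- The free product of `A` and `B` in which `i h` is identified with `j h` for all `h : H`.
It is the amalgamated free product `A *_H B` when `i` and `j` are injective. -/
abbrev Amalgam {H A B : Type} [Group H] [Group A] [Group B] (i : H →* A) (j : H →* B) : Type :=
  Monoid.PushoutI (Amalgam.famHom i j)

namespace Amalgam

variable {H A B : Type} [Group H] [Group A] [Group B]

/-- The canonical map from the left factor to the amalgamated product. -/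
def inl (i : H →* A) (j : H →* B) : A →* Amalgam i j :=
  Monoid.PushoutI.of (φ := famHom i j) false

/-- The canonical map from the right factor to the amalgamated product. -/
def inr (i : H →* A) (j : H →* B) : B →* Amalgam i j :=
  Monoid.PushoutI.of (φ := famHom i j) true

end Amalgam

/-- The letter `α` of the free group on two letters. -/
def genA : FreeGroup (Fin 2) := FreeGroup.of 0

/-- The letter `β` of the free group on two letters. -/
def genB : FreeGroup (Fin 2) := FreeGroup.of 1

/-- `⟨α, β : rels⟩` is a presentation of the subgroup `G`, with `α` corresponding to `a` and
`β` corresponding to `b`. -/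
def HasPresentation {K : Type} [Group K] (G : Subgroup K) (a b : K)
    (rels : Set (FreeGroup (Fin 2))) : Prop :=
  ∃ e : PresentedGroup rels ≃* G,
    (e (PresentedGroup.of 0) : K) = a ∧ (e (PresentedGroup.of 1) : K) = b

/-! In each case the group is `D_m *_H B`, where `B` is a group of rotational symmetries of the cube
(`ℤ/4`, the dihedral group of order 8 about the `y`-axis, or `Ghat 4 4`) and `H` corresponds to the
elements of `D_m` that also lie in `B`. The point is that the canonical map from the amalgam to
`SO3` is injective.

This is proved by a 2-adic ping-pong on `ℝ³`. Take a valuation `v` on `ℝ` with `v 2 < 1`. If `θ` is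
a rational multiple of `2π` but not a multiple of `π / 2`, then `cos θ` and `sin θ` have equal
value, greater than 1 (`exists_valuation_cos_sin`): otherwise `exp (4iθ)` would be a root of unity
congruent to 1 modulo 4, hence 1. So a rotation in `D_m` outside `H` sends a vector whose first
coordinate is as large as exactly one dominant coordinate among the last two (`pongSet`) to one
whose last two coordinates are equally large and dominate the first (`pingSet`), and strictly
increases the size. A cube symmetry outside the dihedral group of order 8 about the `x`-axis sends
`pingSet` back to `pongSet` and keeps the size. Hence no nontrivial reduced word acts trivially
(`Amalgam.lift_injective_of_ping_pong`).

The presentations follow: the relators provide maps from both factors to the presented group that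
agree on `H`, hence a map from the amalgam that inverts the canonical one. When 4 divides `m` this
needs a presentation of `Ghat 4 4`, obtained by enumerating three cosets. -/

/-! ### Homomorphisms out of cyclic and dihedral groups. -/

/-- The homomorphism from the cyclic group of order `n` that sends the generator to `x`. -/
def cyclicLift {G : Type*} [Group G] (n : ℕ) (x : G) (hx : x ^ n = 1) :
    Multiplicative (ZMod n) →* G :=
  AddMonoidHom.toMultiplicativeLeft
    (ZMod.lift n ⟨zmultiplesHom (Additive G) (Additive.ofMul x), by
      simpa using congrArg Additive.ofMul hx⟩)

theorem cyclicLift_intCast {G : Type*} [Group G] (n : ℕ) (x : G) (hx : x ^ n = 1) (k : ℤ) :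
    cyclicLift n x hx (Multiplicative.ofAdd (k : ZMod n)) = x ^ k := by
  simp [cyclicLift]

theorem cyclicLift_one {G : Type*} [Group G] (n : ℕ) (x : G) (hx : x ^ n = 1) :
    cyclicLift n x hx (Multiplicative.ofAdd 1) = x := by
  simpa using cyclicLift_intCast n x hx 1

theorem cyclicHom_ext {G : Type*} [Group G] {n : ℕ} {f g : Multiplicative (ZMod n) →* G}
    (h : f (Multiplicative.ofAdd 1) = g (Multiplicative.ofAdd 1)) : f = g := by
  refine DFunLike.ext _ _ fun a => ?_
  obtain ⟨a, rfl⟩ := Multiplicative.ofAdd.surjective a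
  obtain ⟨k, rfl⟩ := ZMod.intCast_surjective a
  have : Multiplicative.ofAdd (k : ZMod n) = Multiplicative.ofAdd (1 : ZMod n) ^ k := by
    rw [← ofAdd_zsmul]; simp
  rw [this, map_zpow, map_zpow, h]

namespace DihedralGroup

variable {G : Type*} [Group G] {n : ℕ}

theorem conj_cyclicLift {x y : G} (hx : x ^ n = 1) (hxy : y * x * y⁻¹ = x⁻¹) (a : ZMod n) :
    cyclicLift n x hx (Multiplicative.ofAdd a) * y⁻¹ =
      y⁻¹ * cyclicLift n x hx (Multiplicative.ofAdd (-a)) := by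
  obtain ⟨k, rfl⟩ := ZMod.intCast_surjective a
  rw [← Int.cast_neg, cyclicLift_intCast, cyclicLift_intCast, zpow_neg, ← inv_zpow, ← hxy,
    conj_zpow]
  group

/-- The homomorphism from the dihedral group given by images `x` of the rotation `r 1` and
`y` of the reflection `sr 0`. -/
def lift (n : ℕ) (x y : G) (hx : x ^ n = 1) (hy : y ^ 2 = 1) (hxy : y * x * y⁻¹ = x⁻¹) :
    DihedralGroup n →* G where
  toFun
    | r a => cyclicLift n x hx (Multiplicative.ofAdd a)
    | sr a => y * cyclicLift n x hx (Multiplicative.ofAdd a)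
  map_one' := by
    rw [one_def]
    simp
  map_mul' := by
    have hy' : y⁻¹ = y := inv_eq_of_mul_eq_one_left (by rw [← sq, hy])
    have h := conj_cyclicLift hx hxy
    rw [hy'] at h
    have hyy : y * y = 1 := by rw [← sq, hy]
    rintro (a | a) (b | b)
    · simp [r_mul_r]
    · simp only [r_mul_sr]
      rw [← mul_assoc, h, mul_assoc, ← map_mul, ← ofAdd_add, neg_add_eq_sub]
    · simp [sr_mul_r, mul_assoc]
    · simp only [sr_mul_sr]
      rw [mul_assoc, ← mul_assoc _ y, h, mul_assoc, ← mul_assoc y, hyy, one_mul, ← map_mul,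
        ← ofAdd_add, neg_add_eq_sub]

section

variable (n : ℕ) (x y : G) (hx : x ^ n = 1) (hy : y ^ 2 = 1) (hxy : y * x * y⁻¹ = x⁻¹)

theorem lift_r_intCast (k : ℤ) : lift n x y hx hy hxy (r (k : ZMod n)) = x ^ k :=
  cyclicLift_intCast n x hx k

theorem lift_sr_intCast (k : ℤ) : lift n x y hx hy hxy (sr (k : ZMod n)) = y * x ^ k :=
  congrArg (y * ·) (cyclicLift_intCast n x hx k)

theorem lift_r_one : lift n x y hx hy hxy (r 1) = x := by
  simpa using lift_r_intCast n x y hx hy hxy 1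

theorem lift_sr_zero : lift n x y hx hy hxy (sr 0) = y := by
  simpa using lift_sr_intCast n x y hx hy hxy 0

theorem lift_mem {S : Subgroup G} (hxS : x ∈ S) (hyS : y ∈ S) (a : DihedralGroup n) :
    lift n x y hx hy hxy a ∈ S := by
  rcases a with a | a <;> obtain ⟨k, rfl⟩ := ZMod.intCast_surjective a
  · rw [lift_r_intCast]
    exact zpow_mem hxS k
  · rw [lift_sr_intCast]
    exact mul_mem hyS (zpow_mem hxS k)

end

theorem hom_ext {f g : DihedralGroup n →* G} (hr : f (r 1) = g (r 1))
    (hs : f (sr 0) = g (sr 0)) : f = g := by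
  have h (a : ZMod n) : f (r a) = g (r a) := by
    obtain ⟨k, rfl⟩ := ZMod.intCast_surjective a
    rw [← r_one_zpow, map_zpow, map_zpow, hr]
  ext a
  rcases a with a | a
  · exact h a
  · have : (sr a : DihedralGroup n) = sr 0 * r a := by simp [sr_mul_r]
    rw [this, map_mul, map_mul, hs, h]

end DihedralGroup

/-! ### Coset enumeration for the rotation group of the cube. -/

/-- Left multiplication by the generators permutes the three left cosets of the image of the
dihedral group of order eight in a quotient of the rotation group of the cube. -/
theorem mem_cosets_of_mem_closure {G : Type*} [Group G] {a b : G} (ha : a ^ 4 = 1)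
    (hb : b ^ 4 = 1) (h2 : (a ^ 2 * b) ^ 2 = 1) (h3 : (a * b) ^ 3 = 1)
    (d : DihedralGroup 4 →* G) (hda : d (.r 1) = a) (hdb : d (.sr 0) = b ^ 2) {g : G}
    (hg : g ∈ Subgroup.closure {a, b}) :
    ∃ h, g = d h ∨ g = b * d h ∨ g = a * b * d h := by
  have h2' : a ^ 2 * b = b * (b ^ 2 * a ^ 2) := by
    have : a ^ 2 * b = (a ^ 2 * b)⁻¹ := eq_inv_of_mul_eq_one_left (by rw [← sq, h2])
    calc a ^ 2 * b = (a ^ 2 * b)⁻¹ := this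
      _ = b ^ 4 * b⁻¹ * (a ^ 4 * (a ^ 2)⁻¹) := by rw [ha, hb]; group
      _ = b * (b ^ 2 * a ^ 2) := by group
  -- `e1` and `e2` are the two nontrivial entries of the coset table: `a` sends the coset of `a * b`
  -- to that of `b`, and `b` fixes the coset of `a * b`.
  have e1 : a * (a * b) = b * (b ^ 2 * a ^ 2) := by
    rw [← h2', sq, mul_assoc]
  have e2 : b * (a * b) = a * b * (b ^ 2 * a ^ 2 * b ^ 2 * a⁻¹) := by
    have : b * (a * b) = a⁻¹ * b⁻¹ * a⁻¹ := by
      calc b * (a * b) = a⁻¹ * (a * b) ^ 3 * b⁻¹ * a⁻¹ := by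
            simp [pow_succ, mul_assoc]
        _ = a⁻¹ * b⁻¹ * a⁻¹ := by rw [h3, mul_one]
    calc b * (a * b) = a⁻¹ * b⁻¹ * a⁻¹ := this
      _ = a ^ 4 * a⁻¹ * (b⁻¹ * b ^ 4) * a⁻¹ := by rw [ha, hb]; simp
      _ = a * (a ^ 2 * b) * b ^ 2 * a⁻¹ := by group
      _ = a * b * (b ^ 2 * a ^ 2 * b ^ 2 * a⁻¹) := by rw [h2']; simp only [mul_assoc]
  let X : Set G := {g | ∃ h, g = d h ∨ g = b * d h ∨ g = a * b * d h}
  have keyA : ∀ g ∈ X, a * g ∈ X := by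
    rintro g ⟨h, rfl | rfl | rfl⟩
    · exact ⟨.r 1 * h, .inl (by rw [map_mul, hda])⟩
    · exact ⟨h, .inr (.inr (by rw [mul_assoc]))⟩
    · refine ⟨.sr 0 * .r 1 ^ 2 * h, .inr (.inl ?_)⟩
      simp only [map_mul, map_pow, hda, hdb, ← mul_assoc] at e1 ⊢
      rw [e1]
  have keyB : ∀ g ∈ X, b * g ∈ X := by
    rintro g ⟨h, rfl | rfl | rfl⟩
    · exact ⟨h, .inr (.inl rfl)⟩
    · exact ⟨.sr 0 * h, .inl (by rw [map_mul, hdb, sq, mul_assoc])⟩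
    · refine ⟨.sr 0 * .r 1 ^ 2 * .sr 0 * (.r 1)⁻¹ * h, .inr (.inr ?_)⟩
      simp only [map_mul, map_pow, map_inv, hda, hdb, ← mul_assoc] at e2 ⊢
      rw [e2]
  -- Both generators have order dividing 4, so their inverses are their cubes.
  have keyInv : ∀ c : G, c ^ 4 = 1 → (∀ g ∈ X, c * g ∈ X) → ∀ g ∈ X, c⁻¹ * g ∈ X := by
    intro c hc hX g hg
    have : c⁻¹ = c * (c * c) := by
      rw [inv_eq_iff_mul_eq_one, ← hc]; simp [pow_succ, mul_assoc]
    rw [this, mul_assoc, mul_assoc]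
    exact hX _ (hX _ (hX _ hg))
  change g ∈ X
  induction hg using Subgroup.closure_induction_left with
  | one => exact ⟨1, .inl (map_one d).symm⟩
  | mul_left x hx y _ hy =>
    rcases hx with rfl | rfl
    exacts [keyA _ hy, keyB _ hy]
  | inv_mul_cancel x hx y _ hy =>
    rcases hx with rfl | rfl
    exacts [keyInv _ ha keyA _ hy, keyInv _ hb keyB _ hy]

/-! ### Ping-pong for amalgamated products. -/

/-- Ping-pong for an amalgamated product of two groups acting on `X`: the elements of `A` outside
`H` move `Q` into `P` and increase the size `N`, those of `B` outside `H` move `P` into `Q` and do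
not decrease it. -/
theorem Amalgam.lift_injective_of_ping_pong {H A B K X Γ : Type} [Group H] [Group A] [Group B]
    [Group K] [MulAction K X] [LinearOrder Γ] {i : H →* A} {j : H →* B}
    (f : Amalgam i j →* K)
    (hH : Function.Injective (fun h => f (Amalgam.inl i j (i h))))
    (P Q : Set X) (N : X → Γ) (hPQ : Disjoint P Q) (hP : P.Nonempty) (hQ : Q.Nonempty)
    (hA : ∀ a ∉ i.range, ∀ x ∈ Q,
      f (Amalgam.inl i j a) • x ∈ P ∧ N x < N (f (Amalgam.inl i j a) • x))
    (hB : ∀ b ∉ j.range, ∀ x ∈ P,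
      f (Amalgam.inr i j b) • x ∈ Q ∧ N x ≤ N (f (Amalgam.inr i j b) • x)) :
    Function.Injective f := by
  have hij (h : H) : Amalgam.inl i j (i h) = Amalgam.inr i j (j h) :=
    (Monoid.PushoutI.of_apply_eq_base (famHom i j) false h).trans
      (Monoid.PushoutI.of_apply_eq_base (famHom i j) true h).symm
  have hφ : ∀ t, Function.Injective (famHom i j t) := by
    rintro (_ | _)
    · exact fun x y hxy => hH (congrArg (fun a => f (Amalgam.inl i j a)) hxy)
    · intro x y hxy
      apply hH
      simp only [hij]
      exact congrArg (fun b => f (Amalgam.inr i j b)) hxy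
  obtain ⟨d⟩ := Monoid.PushoutI.NormalWord.transversal_nonempty (famHom i j) hφ
  let Y : Bool → Set X := fun t => if t then Q else P
  have hA' (g : Fam A B false) (hg : g ∉ (famHom i j false).range) (x : X) (hx : x ∈ Q) :
      f (Monoid.PushoutI.of false g) • x ∈ P ∧ N x < N (f (Monoid.PushoutI.of false g) • x) :=
    hA g hg x hx
  have hB' (g : Fam A B true) (hg : g ∉ (famHom i j true).range) (x : X) (hx : x ∈ P) :
      f (Monoid.PushoutI.of true g) • x ∈ Q ∧ N x ≤ N (f (Monoid.PushoutI.of true g) • x) :=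
    hB g hg x hx
  -- The letters act from the right end of the list. A single letter from `A` already increases `N`
  -- strictly, and later letters never decrease it; the second alternative therefore occurs only for
  -- a single letter from `B`, where `P` and `Q` being disjoint replaces the growth of `N`.
  have hl (l : List (Σ t, Fam A B t)) (hne : l ≠ [])
      (hl : ∀ s ∈ l, s.2 ∉ (famHom i j s.1).range)
      (hc : l.IsChain fun s s' => s.1 ≠ s'.1) :
      ∃ x y, y = (l.map fun s => f (Monoid.PushoutI.of s.1 s.2)).prod • x ∧
        (∀ s ∈ l.head?, y ∈ Y s.1) ∧ (N x < N y ∨ x ∈ P ∧ y ∈ Q ∧ N x ≤ N y) := by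
    induction l with
    | nil => exact absurd rfl hne
    | cons s l ih =>
      rcases l with _ | ⟨s', l⟩
      · obtain ⟨_ | _, g⟩ := s
        · obtain ⟨x, hx⟩ := hQ
          have := hA' g (hl ⟨false, g⟩ (by simp)) x hx
          exact ⟨x, _, rfl, by simpa [Y] using this.1, .inl (by simpa using this.2)⟩
        · obtain ⟨x, hx⟩ := hP
          have := hB' g (hl ⟨true, g⟩ (by simp)) x hx
          exact ⟨x, _, rfl, by simpa [Y] using this.1,
            .inr ⟨hx, by simpa using this.1, by simpa using this.2⟩⟩
      · obtain ⟨x, y, hy, hyY, hN⟩ := ih (by simp) (fun s hs => hl s (by simp [hs])) hc.tail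
        rw [List.isChain_cons_cons] at hc
        replace hyY := hyY s' (by simp)
        refine ⟨x, f (Monoid.PushoutI.of s.1 s.2) • y, ?_, ?_⟩
        · rw [List.map_cons, List.prod_cons, mul_smul, hy]
        obtain ⟨_ | _, g⟩ := s <;> obtain ⟨_ | _, g'⟩ := s'
        · simp at hc
        · have := hA' g (hl ⟨false, g⟩ (by simp)) y (by simpa [Y] using hyY)
          refine ⟨by simpa [Y] using this.1, .inl ?_⟩
          rcases hN with hN | hN
          exacts [hN.trans this.2, hN.2.2.trans_lt this.2]
        · have hyP : y ∈ P := by simpa [Y] using hyY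
          have := hB' g (hl ⟨true, g⟩ (by simp)) y hyP
          refine ⟨by simpa [Y] using this.1, .inl ?_⟩
          rcases hN with hN | hN
          exacts [hN.trans_le this.2, (Set.disjoint_left.1 hPQ hyP hN.2.1).elim]
        · simp at hc
  have hd (t : Bool) (g : Fam A B t) (hg : g ∈ d.set t) (h1 : g ≠ 1) :
      g ∉ (famHom i j t).range := by
    intro hr
    -- The transversal contains 1, so an element `g` of it in the image of `H` factors both as `g *
    -- 1` and as `1 * g`; uniqueness forces `g = 1`.
    have := @(d.compl t).1 (⟨g, hr⟩, ⟨1, d.one_mem t⟩) (1, ⟨g, hg⟩) (by simp)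
    exact h1 (congrArg (fun p => (p.1 : Fam A B t)) this)
  classical
  rw [injective_iff_map_eq_one]
  intro g hg
  obtain ⟨w, rfl⟩ := (Monoid.PushoutI.NormalWord.equiv (d := d)).symm.surjective g
  change f w.prod = 1 at hg
  change w.prod = 1
  obtain ⟨⟨l, h1, hc⟩, h, hn⟩ := w
  simp only [Monoid.PushoutI.NormalWord.prod, Monoid.CoprodI.Word.prod, map_mul, map_list_prod,
    List.map_map] at hg ⊢
  rcases l with _ | ⟨s, l⟩
  · rw [← Monoid.PushoutI.of_apply_eq_base (famHom i j) false] at hg ⊢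
    have : h = 1 := by
      apply hH
      have hg' : f (Monoid.PushoutI.of false (famHom i j false h)) = 1 := by simpa using hg
      exact hg'.trans (by simp)
    simp [this]
  · exfalso
    have hr : ∀ s' ∈ s :: l, s'.2 ∉ (famHom i j s'.1).range := fun s' hs' =>
      hd _ _ (hn _ _ hs') (h1 _ hs')
    -- The leading element of `H` is absorbed into the first letter, which stays outside the image
    -- of `H`.
    obtain ⟨x, y, hy, -, hN⟩ := hl (⟨s.1, famHom i j s.1 h * s.2⟩ :: l) (by simp) (by
      intro s' hs'
      rcases List.mem_cons.1 hs' with rfl | hs'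
      · have := hr s (by simp)
        rwa [Subgroup.mul_mem_cancel_left _ (MonoidHom.mem_range.2 ⟨h, rfl⟩)]
      · exact hr s' (by simp [hs'])) (by
        rcases l with _ | ⟨s', l⟩
        · simp
        · rw [List.isChain_cons_cons] at hc ⊢
          exact hc)
    have : (1 : K) • x = y := by
      rw [hy, ← hg]
      simp [Function.comp_def, mul_assoc, Monoid.PushoutI.of_apply_eq_base]
    rw [one_smul] at this
    subst this
    rcases hN with hN | hN
    exacts [hN.false, Set.disjoint_left.1 hPQ hN.1 hN.2.1]

/-! ### Criteria for a presentation. -/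

theorem hasPresentation_of_injective {K : Type} [Group K] {G : Subgroup K} {a b : K}
    {rels : Set (FreeGroup (Fin 2))} (hG : G = Subgroup.closure {a, b})
    (hrels : ∀ r ∈ rels, FreeGroup.lift ![a, b] r = 1)
    (hinj : Function.Injective (PresentedGroup.toGroup hrels)) : HasPresentation G a b rels := by
  have hr : (PresentedGroup.toGroup hrels).range = G := by
    rw [hG, MonoidHom.range_eq_map, ← PresentedGroup.closure_range_of, MonoidHom.map_closure]
    congr 1
    ext x
    simp [Fin.exists_fin_two, eq_comm]
  refine ⟨(MonoidHom.ofInjective hinj).trans (MulEquiv.subgroupCongr hr), ?_, ?_⟩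
  · exact PresentedGroup.toGroup.of hrels
  · exact PresentedGroup.toGroup.of hrels

/-- `ψ` is a left inverse of the canonical map from the presented group, because the composite fixes
both generators; so that map is injective. -/
theorem hasPresentation_of_hom {K : Type} [Group K] {G : Subgroup K} {a b : K}
    {rels : Set (FreeGroup (Fin 2))} (hG : G = Subgroup.closure {a, b})
    (hrels : ∀ r ∈ rels, FreeGroup.lift ![a, b] r = 1) (ψ : G →* PresentedGroup rels)
    (ha : ∀ g : G, (g : K) = a → ψ g = .of 0) (hb : ∀ g : G, (g : K) = b → ψ g = .of 1) :
    HasPresentation G a b rels := by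
  apply hasPresentation_of_injective hG hrels
  have hmem (x) : PresentedGroup.toGroup hrels x ∈ G := by
    have : G.comap (PresentedGroup.toGroup hrels) = ⊤ := by
      rw [eq_top_iff, ← PresentedGroup.closure_range_of, Subgroup.closure_le]
      rintro _ ⟨t, rfl⟩
      simp only [Subgroup.coe_comap, Set.mem_preimage, SetLike.mem_coe, PresentedGroup.toGroup.of]
      rw [hG]
      fin_cases t <;> exact Subgroup.subset_closure (by simp)
    exact (this ▸ Subgroup.mem_top x : x ∈ G.comap (PresentedGroup.toGroup hrels))
  have hid : ψ.comp ((PresentedGroup.toGroup hrels).codRestrict G hmem) = MonoidHom.id _ := by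
    apply PresentedGroup.ext
    intro t
    fin_cases t
    · exact ha _ (PresentedGroup.toGroup.of hrels)
    · exact hb _ (PresentedGroup.toGroup.of hrels)
  intro x y hxy
  rw [← MonoidHom.id_apply _ x, ← MonoidHom.id_apply _ y, ← hid]
  exact congrArg ψ (Subtype.ext hxy)

/-! ### Roots of unity, cosines and sines at a place above 2. -/

namespace Valuation

variable {K Γ : Type*} [Field K] [LinearOrderedCommGroupWithZero Γ] (v : Valuation K Γ)

theorem map_natCast_le_one' (n : ℕ) : v n ≤ 1 := by
  induction n with
  | zero => simp
  | succ n ih =>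
    push_cast
    exact v.map_add_le ih (by simp)

theorem map_eq_one_of_pow_eq_one {x : K} {n : ℕ} (hn : 0 < n) (hx : x ^ n = 1) : v x = 1 := by
  have : v x ^ n = 1 := by rw [← map_pow, hx, map_one]
  exact (pow_eq_one_iff_of_nonneg zero_le hn.ne').1 this

/-- The quotient of `x ^ k - 1` by `x - 1` is a geometric sum, all of whose terms have value at most
1. -/
theorem map_pow_sub_one_le {x : K} (hx : v x ≤ 1) (k : ℕ) : v (x ^ k - 1) ≤ v (x - 1) := by
  rw [← mul_geom_sum, map_mul]
  refine mul_le_of_le_one_right' (v.map_sum_le fun i _ => ?_)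
  rw [map_pow]
  exact pow_le_one' hx i

/-- A root of unity congruent to `1` modulo `4` at a place above `2` equals `1`. -/
theorem eq_one_of_pow_eq_one_of_map_sub_one_le [CharZero K] (h2 : v 2 < 1) {x : K} {n : ℕ}
    (hn : 0 < n) (hx : x ^ n = 1) (h4 : v (x - 1) ≤ v 4) : x = 1 := by
  have h20 : 0 < v 2 := by simp [zero_lt_iff]
  have h42 : v 4 < v 2 := by
    have : (4 : K) = 2 * 2 := by norm_num
    rw [this, map_mul]
    exact mul_lt_of_lt_one_left h20 h2
  have hvx : v x ≤ 1 := (v.map_eq_one_of_pow_eq_one hn hx).le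
  induction n using Nat.strong_induction_on with
  | _ n ih =>
    rcases Nat.even_or_odd' n with ⟨k, rfl | rfl⟩
    · rw [mul_comm, pow_mul, sq_eq_one_iff] at hx
      rcases hx with hx | hx
      · exact ih k (by omega) (by omega) hx
      -- If `x ^ k = -1`, then `v 2 = v (x ^ k - 1) ≤ v (x - 1) ≤ v 4 < v 2`.
      · have := v.map_pow_sub_one_le hvx k
        rw [hx, show (-1 - 1 : K) = -2 by norm_num, map_neg] at this
        exact absurd (this.trans h4) (not_le.2 h42)
    · by_contra hne
      have hs := mul_geom_sum x (2 * k + 1)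
      rw [hx, sub_self, mul_eq_zero, or_iff_right (sub_ne_zero.2 hne)] at hs
      -- The `2 * k + 1` powers of `x` sum to 0 although each is congruent to 1, so the odd number
      -- `2 * k + 1` would have value less than 1.
      have h1 : (1 : K) = - (∑ i ∈ Finset.range (2 * k + 1), (x ^ i - 1)) - 2 * k := by
        rw [Finset.sum_sub_distrib, hs]
        simp
      have : v (1 : K) < 1 := by
        rw [h1]
        refine v.map_sub_lt ?_ ?_
        · rw [map_neg]
          exact v.map_sum_lt one_ne_zero fun i _ =>
            ((v.map_pow_sub_one_le hvx i).trans h4).trans_lt (h42.trans h2)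
        · rw [map_mul]
          exact mul_lt_one_of_lt_of_le h2 (v.map_natCast_le_one' k)
      simp at this

end Valuation

/-- In characteristic zero, 2 generates a proper ideal of the copy of `ℤ` in `K`, and a proper ideal
of a subring lies in the nonunits of some valuation ring of `K`. -/
theorem exists_valuation_two_lt_one (K : Type*) [Field K] [CharZero K] :
    ∃ V : ValuationSubring K, V.valuation 2 < 1 := by
  have hI : Ideal.span {(2 : ℤ)} ≠ ⊤ := by
    rw [Ne, Ideal.span_singleton_eq_top, Int.isUnit_iff]
    norm_num
  let e := (Int.castRingHom K)
  let I : Ideal e.range := (Ideal.span {(2 : ℤ)}).map e.rangeRestrict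
  have hI' : I ≠ ⊤ := by
    have hinj : Function.Injective e.rangeRestrict := fun a b hab =>
      Int.cast_injective (α := K) (congrArg Subtype.val hab)
    intro h
    have h1 : (1 : e.range) ∈ I := h ▸ Submodule.mem_top
    obtain ⟨x, hx, hx1⟩ := (Ideal.mem_map_iff_of_surjective _ e.rangeRestrict_surjective).1 h1
    rw [← map_one e.rangeRestrict] at hx1
    exact hI ((Ideal.eq_top_iff_one _).2 (hinj hx1 ▸ hx))
  obtain ⟨V, -, hV⟩ := I.image_subset_nonunits_valuationSubring hI'
  refine ⟨V, ?_⟩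
  rw [← ValuationSubring.mem_nonunits_iff]
  refine hV ⟨e.rangeRestrict 2, Ideal.mem_map_of_mem _ (Ideal.mem_span_singleton_self 2), ?_⟩
  exact map_ofNat e 2

/-- At a place above `2`, the cosine and the sine of a rational multiple of `2π` that is not a
multiple of `π / 2` have the same value, which is greater than one. -/
theorem exists_valuation_cos_sin :
    ∃ (Γ : Type) (_ : LinearOrderedCommGroupWithZero Γ) (v : Valuation ℝ Γ),
      ∀ (m : ℕ) (k : ℤ) (θ : ℝ), 0 < m → m * θ = k * (2 * π) → ¬ (m : ℤ) ∣ 4 * k →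
        1 < v (cos θ) ∧ v (sin θ) = v (cos θ) := by
  obtain ⟨V, hV⟩ := exists_valuation_two_lt_one ℂ
  let w := V.valuation
  -- The place is chosen on `ℂ` and restricted to `ℝ`, so that it also applies to `exp (iθ)`.
  refine ⟨V.ValueGroup, inferInstance, w.comap Complex.ofRealHom, fun m k θ hm hθ hk => ?_⟩
  set v := w.comap Complex.ofRealHom with hv
  have hcos : 1 < v (cos θ) := by
    by_contra! hle
    let z := Complex.exp (θ * Complex.I)
    have hz0 : z ≠ 0 := Complex.exp_ne_zero _
    have hzm : z ^ m = 1 := by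
      rw [← Complex.exp_nat_mul, Complex.exp_eq_one_iff]
      refine ⟨k, ?_⟩
      have := congrArg (fun t : ℝ => (t : ℂ)) hθ
      push_cast at this
      linear_combination this * Complex.I
    have hvz : w z = 1 := w.map_eq_one_of_pow_eq_one hm hzm
    have hz2 : z ^ 2 + 1 = 2 * (cos θ : ℂ) * z := by
      have h : 2 * (cos θ : ℂ) = z + z⁻¹ := by
        rw [Complex.ofReal_cos, Complex.two_cos, ← Complex.exp_neg, neg_mul]
      rw [h]
      field_simp
    have h1 : w (z ^ 2 + 1) ≤ w 2 := by
      rw [hz2, map_mul, map_mul, hvz, mul_one]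
      exact mul_le_of_le_one_right' hle
    have h2 : w (z ^ 2 - 1) ≤ w 2 := by
      rw [show z ^ 2 - 1 = (z ^ 2 + 1) - 2 by ring]
      exact w.map_sub_le h1 le_rfl
    have h4 : z ^ 4 = 1 := by
      refine w.eq_one_of_pow_eq_one_of_map_sub_one_le hV (n := m) hm ?_ ?_
      · rw [← pow_mul, mul_comm, pow_mul, hzm, one_pow]
      · rw [show z ^ 4 - 1 = (z ^ 2 + 1) * (z ^ 2 - 1) by ring, map_mul,
          show (4 : ℂ) = 2 * 2 by norm_num, map_mul]
        exact mul_le_mul' h1 h2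
    rw [← Complex.exp_nat_mul, Complex.exp_eq_one_iff] at h4
    obtain ⟨l, hl⟩ := h4
    have hl' : 4 * θ = l * (2 * π) := by
      have : ((4 * θ : ℝ) : ℂ) = ((l * (2 * π) : ℝ) : ℂ) := by
        push_cast at hl ⊢
        have hI := Complex.I_ne_zero
        apply mul_right_cancel₀ hI
        linear_combination hl
      exact_mod_cast this
    refine hk ⟨l, ?_⟩
    have hπ : (2 * π) ≠ 0 := by positivity
    have : (4 * k : ℝ) = m * l := by
      apply mul_right_cancel₀ hπ
      linear_combination m * hl' - 4 * hθ
    exact_mod_cast this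
  refine ⟨hcos, ?_⟩
  -- In `1 - cos θ ^ 2` the second term dominates.
  have hsq : v (sin θ) ^ 2 = v (cos θ) ^ 2 := by
    rw [← map_pow, ← map_pow, Real.sin_sq, v.map_sub_eq_of_lt_right]
    rw [map_one, map_pow]
    exact one_lt_pow₀ hcos two_ne_zero
  exact (pow_left_inj₀ zero_le zero_le two_ne_zero).1 hsq

/-! ### The universal property of the amalgam. -/

namespace Amalgam

/-- Two homomorphisms `A →* K` and `B →* K` as a family. -/
def famDesc {A B K : Type} [Group A] [Group B] [Group K] (f : A →* K) (g : B →* K) :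
    ∀ t, Fam A B t →* K
  | false => f
  | true => g

theorem famDesc_comp {H A B K : Type} [Group H] [Group A] [Group B] [Group K] {i : H →* A}
    {j : H →* B} {f : A →* K} {g : B →* K} (h : f.comp i = g.comp j) (t : Bool) :
    (famDesc f g t).comp (famHom i j t) = f.comp i := by
  cases t
  · rfl
  · exact h.symm

/-- The homomorphism from an amalgamated product given by compatible homomorphisms from the
factors. -/
def lift {H A B K : Type} [Group H] [Group A] [Group B] [Group K] {i : H →* A} {j : H →* B}
    (f : A →* K) (g : B →* K) (h : f.comp i = g.comp j) : Amalgam i j →* K :=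
  Monoid.PushoutI.lift (famDesc f g) (f.comp i) (famDesc_comp h)

section

variable {H A B K : Type} [Group H] [Group A] [Group B] [Group K] {i : H →* A} {j : H →* B}
  (f : A →* K) (g : B →* K) (h : f.comp i = g.comp j)

theorem lift_inl (a : A) : lift f g h (inl i j a) = f a :=
  Monoid.PushoutI.lift_of (famDesc f g) (f.comp i) (famDesc_comp h) (i := false) a

theorem lift_inr (b : B) : lift f g h (inr i j b) = g b :=
  Monoid.PushoutI.lift_of (famDesc f g) (f.comp i) (famDesc_comp h) (i := true) b

theorem lift_range_le {G : Subgroup K} (hf : ∀ a, f a ∈ G) (hg : ∀ b, g b ∈ G) :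
    (lift f g h).range ≤ G := by
  rintro _ ⟨x, rfl⟩
  induction x using Monoid.PushoutI.induction_on with
  | of t c =>
    cases t
    · exact lift_inl f g h c ▸ hf c
    · exact lift_inr f g h c ▸ hg c
  | base c =>
    rw [← Monoid.PushoutI.of_apply_eq_base (famHom i j) false]
    exact lift_inl f g h (i c) ▸ hf (i c)
  | mul x y hx hy =>
    rw [map_mul]
    exact mul_mem hx hy

end

end Amalgam

/-! ### The action on `ℝ³` and the relations between the rotations. -/

instance : MulAction SO3 (Fin 3 → ℝ) where
  smul g x := g.1.mulVec x
  one_smul x := Matrix.one_mulVec x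
  mul_smul g h x := (Matrix.mulVec_mulVec x g.1 h.1).symm

theorem Rx_smul (θ : ℝ) (x : Fin 3 → ℝ) :
    Rx θ • x = ![x 0, cos θ * x 1 - sin θ * x 2, sin θ * x 1 + cos θ * x 2] := by
  ext i
  fin_cases i <;> simp [Rx, rotMatX, Matrix.mulVec, dotProduct, Fin.sum_univ_three]
  ring

theorem Ry_pi_div_two_smul (x : Fin 3 → ℝ) : Ry (π / 2) • x = ![x 2, x 1, -x 0] := by
  ext i
  fin_cases i <;> simp [Ry, rotMatY, Matrix.mulVec, dotProduct, Fin.sum_univ_three]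

theorem Ry_pi_div_two_sq_smul (x : Fin 3 → ℝ) : Ry (π / 2) ^ 2 • x = ![-x 0, x 1, -x 2] := by
  rw [sq, mul_smul, Ry_pi_div_two_smul, Ry_pi_div_two_smul]
  simp

theorem Rx_mul (a b : ℝ) : Rx a * Rx b = Rx (a + b) := by
  ext i j
  fin_cases i <;> fin_cases j <;>
    simp [Rx, rotMatX, cos_add, sin_add] <;> ring

theorem Ry_mul (a b : ℝ) : Ry a * Ry b = Ry (a + b) := by
  ext i j
  fin_cases i <;> fin_cases j <;>
    simp [Ry, rotMatY, cos_add, sin_add] <;> ring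

theorem Rx_zpow (θ : ℝ) (k : ℤ) : Rx θ ^ k = Rx (k * θ) := by
  let f : Multiplicative ℝ →* SO3 := MonoidHom.mk' (fun t => Rx t.toAdd) fun a b =>
    (Rx_mul a.toAdd b.toAdd).symm
  have := map_zpow f (Multiplicative.ofAdd θ) k
  rw [← ofAdd_zsmul, zsmul_eq_mul] at this
  exact this.symm

theorem Ry_zpow (θ : ℝ) (k : ℤ) : Ry θ ^ k = Ry (k * θ) := by
  let f : Multiplicative ℝ →* SO3 := MonoidHom.mk' (fun t => Ry t.toAdd) fun a b =>
    (Ry_mul a.toAdd b.toAdd).symm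
  have := map_zpow f (Multiplicative.ofAdd θ) k
  rw [← ofAdd_zsmul, zsmul_eq_mul] at this
  exact this.symm

theorem Rx_pow (θ : ℝ) (k : ℕ) : Rx θ ^ k = Rx (k * θ) := by
  simpa using Rx_zpow θ k

theorem Ry_pow (θ : ℝ) (k : ℕ) : Ry θ ^ k = Ry (k * θ) := by
  simpa using Ry_zpow θ k

theorem Rx_two_pi : Rx (2 * π) = 1 := by
  ext i j
  fin_cases i <;> fin_cases j <;> simp [Rx, rotMatX]

theorem Rx_two_pi_div_pow {m : ℕ} (hm : 0 < m) : Rx (2 * π / m) ^ m = 1 := by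
  rw [Rx_pow, mul_div_cancel₀ _ (by positivity), Rx_two_pi]

theorem Rx_two_pi_div_pow_div {m n : ℕ} (hm : 0 < m) (hn : n ∣ m) :
    Rx (2 * π / m) ^ (m / n) = Rx (2 * π / n) := by
  obtain ⟨k, rfl⟩ := hn
  have h := pos_of_mul_pos_left hm (Nat.zero_le k)
  have hk : k ≠ 0 := by
    rintro rfl
    simp at hm
  rw [Rx_pow, Nat.mul_div_cancel_left _ h]
  congr 1
  push_cast
  field_simp

theorem Ry_two_pi : Ry (2 * π) = 1 := by
  ext i j
  fin_cases i <;> fin_cases j <;> simp [Ry, rotMatY]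

theorem Ry_pi_div_two_pow_four : Ry (π / 2) ^ 4 = 1 := by
  rw [Ry_pow, ← Ry_two_pi]
  congr 1
  push_cast
  ring

theorem Ry_pi_div_two_sq : Ry (π / 2) ^ 2 = Ry π := by
  rw [Ry_pow]
  congr 1
  push_cast
  ring

theorem Rx_mul_Ry_pi_div_two_sq_sq (θ : ℝ) : (Rx θ * Ry (π / 2) ^ 2) ^ 2 = 1 := by
  have h := sin_sq_add_cos_sq θ
  rw [Ry_pi_div_two_sq, sq]
  ext i j
  fin_cases i <;> fin_cases j <;>
    simp [Rx, rotMatX, Ry, rotMatY] <;> linarith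

theorem Rx_pi_mul_Ry_sq (θ : ℝ) : (Rx π * Ry θ) ^ 2 = 1 := by
  have h := sin_sq_add_cos_sq θ
  rw [sq]
  ext i j
  fin_cases i <;> fin_cases j <;>
    simp [Rx, rotMatX, Ry, rotMatY] <;> linarith

theorem Rx_mul_Ry_pi_div_two_pow_three : (Rx (π / 2) * Ry (π / 2)) ^ 3 = 1 := by
  rw [pow_succ, sq]
  ext i j
  fin_cases i <;> fin_cases j <;>
    simp [Rx, rotMatX, Ry, rotMatY]

theorem conj_eq_inv_of_sq_eq_one {G : Type*} [Group G] {x y : G} (hy : y ^ 2 = 1)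
    (hyx : (y * x) ^ 2 = 1) : y * x * y⁻¹ = x⁻¹ := by
  rw [inv_eq_of_mul_eq_one_left (by rw [← sq, hy] : y * y = 1), eq_inv_iff_mul_eq_one, ← hyx, sq,
    mul_assoc]

theorem conj_eq_inv_of_sq_eq_one' {G : Type*} [Group G] {x y : G} (hy : y ^ 2 = 1)
    (hxy : (x * y) ^ 2 = 1) : y * x * y⁻¹ = x⁻¹ := by
  apply conj_eq_inv_of_sq_eq_one hy
  calc (y * x) ^ 2 = y * (x * y) ^ 2 * y⁻¹ := by simp [sq, mul_assoc]
    _ = 1 := by rw [hxy]; simp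

/-! ### The dihedral group about the `x`-axis inside `Ghat m 4`. -/

/-- The dihedral subgroup of `SO(3)` generated by the rotation by `2 * π / m` about the `x`-axis
and the half turn about the `y`-axis. -/
noncomputable def dihedralX (m : ℕ) (hm : 0 < m) : DihedralGroup m →* SO3 :=
  DihedralGroup.lift m (Rx (2 * π / m)) (Ry (π / 2) ^ 2) (Rx_two_pi_div_pow hm)
    (by rw [← pow_mul, Ry_pi_div_two_pow_four])
    (conj_eq_inv_of_sq_eq_one' (by rw [← pow_mul, Ry_pi_div_two_pow_four])
      (Rx_mul_Ry_pi_div_two_sq_sq _))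

section

variable {m : ℕ} (hm : 0 < m)

theorem dihedralX_r (k : ℤ) : dihedralX m hm (.r (k : ZMod m)) = Rx (k * (2 * π / m)) := by
  rw [dihedralX, DihedralGroup.lift_r_intCast, Rx_zpow]

theorem dihedralX_sr (k : ℤ) :
    dihedralX m hm (.sr (k : ZMod m)) = Ry (π / 2) ^ 2 * Rx (k * (2 * π / m)) := by
  rw [dihedralX, DihedralGroup.lift_sr_intCast, Rx_zpow]

theorem dihedralX_r_one : dihedralX m hm (.r 1) = Rx (2 * π / m) :=
  DihedralGroup.lift_r_one ..

theorem dihedralX_sr_zero : dihedralX m hm (.sr 0) = Ry (π / 2) ^ 2 :=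
  DihedralGroup.lift_sr_zero ..

theorem dihedralX_injective : Function.Injective (dihedralX m hm) := by
  rw [injective_iff_map_eq_one]
  rintro (a | a) h <;> obtain ⟨k, rfl⟩ := ZMod.intCast_surjective a
  · rw [dihedralX_r] at h
    have hc := congrFun (congrFun (congrArg Subtype.val h) 1) 1
    simp only [Rx, rotMatX] at hc
    replace hc : cos (k * (2 * π / m)) = 1 := by simpa using hc
    obtain ⟨n, hn⟩ := (cos_eq_one_iff _).1 hc
    have : (k : ℝ) = m * n := by
      field_simp at hn
      linarith
    have : k = m * n := by exact_mod_cast this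
    rw [this, DihedralGroup.one_def]
    simp
  · rw [dihedralX_sr, Ry_pi_div_two_sq] at h
    have hc := congrFun (congrFun (congrArg Subtype.val h) 0) 0
    simp [Rx, rotMatX, Ry, rotMatY] at hc
    norm_num at hc

/-- The dihedral group preserves the `x`-axis. This entry serves to recognise rotations outside the
group. -/
theorem dihedralX_apply_zero_zero_sq (a : DihedralGroup m) :
    (dihedralX m hm a).1 0 0 ^ 2 = 1 := by
  rcases a with a | a <;> obtain ⟨k, rfl⟩ := ZMod.intCast_surjective a
  · simp [dihedralX_r, Rx, rotMatX]
  · rw [dihedralX_sr, Ry_pi_div_two_sq]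
    simp [ Rx, rotMatX, Ry, rotMatY]

end

theorem Ghat_eq_closure (m : ℕ) : Ghat m 4 = Subgroup.closure {Rx (2 * π / m), Ry (π / 2)} := by
  rw [Ghat, show 2 * π / ((4 : ℕ) : ℝ) = π / 2 by push_cast; ring]

theorem two_pi_div_four : 2 * π / ((4 : ℕ) : ℝ) = π / 2 := by
  push_cast
  ring

theorem Rx_two_pi_div_mem_Ghat (m : ℕ) : Rx (2 * π / m) ∈ Ghat m 4 :=
  Ghat_eq_closure m ▸ Subgroup.subset_closure (by simp)

theorem Ry_pi_div_two_mem_Ghat (m : ℕ) : Ry (π / 2) ∈ Ghat m 4 :=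
  Ghat_eq_closure m ▸ Subgroup.subset_closure (by simp)

theorem dihedralX_mem_Ghat {m : ℕ} (hm : 0 < m) (a : DihedralGroup m) :
    dihedralX m hm a ∈ Ghat m 4 :=
  DihedralGroup.lift_mem _ _ _ _ _ _ (Rx_two_pi_div_mem_Ghat m)
    (pow_mem (Ry_pi_div_two_mem_Ghat m) 2) a

theorem Ghat_four_four_le {m : ℕ} (hm : 0 < m) (h : 4 ∣ m) : Ghat 4 4 ≤ Ghat m 4 := by
  rw [Ghat_eq_closure 4, Subgroup.closure_le]
  rintro _ (rfl | rfl)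
  · rw [← Rx_two_pi_div_pow_div hm h]
    exact pow_mem (Rx_two_pi_div_mem_Ghat m) _
  · exact Ry_pi_div_two_mem_Ghat m

theorem Rx_pi_div_two_pow_four : Rx (π / 2) ^ 4 = 1 := by
  rw [← two_pi_div_four, Rx_two_pi_div_pow four_pos]

theorem Rx_pi_div_two_sq : Rx (π / 2) ^ 2 = Rx π := by
  rw [Rx_pow]
  congr 1
  push_cast
  ring

theorem mem_Ghat_four_four {g : SO3} (hg : g ∈ Ghat 4 4) :
    ∃ h, g = dihedralX 4 four_pos h ∨ g = Ry (π / 2) * dihedralX 4 four_pos h ∨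
      g = Rx (π / 2) * Ry (π / 2) * dihedralX 4 four_pos h := by
  rw [Ghat_eq_closure, two_pi_div_four] at hg
  refine mem_cosets_of_mem_closure Rx_pi_div_two_pow_four Ry_pi_div_two_pow_four ?_
    Rx_mul_Ry_pi_div_two_pow_three _ ?_ (dihedralX_sr_zero _) hg
  · rw [Rx_pi_div_two_sq, Rx_pi_mul_Ry_sq]
  · rw [dihedralX_r_one, two_pi_div_four]

/-! ### The ping-pong sets in `ℝ³`. -/

section PingPong

variable {Γ : Type} [LinearOrderedCommGroupWithZero Γ] (v : Valuation ℝ Γ)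

/-- The vectors whose last two coordinates have the same value, greater than that of the first. -/
def pingSet : Set (Fin 3 → ℝ) := {x | v (x 1) = v (x 2) ∧ v (x 0) < v (x 1)}

/-- The vectors of which exactly one of the last two coordinates has the value of the first, the
other one having smaller value. -/
def pongSet : Set (Fin 3 → ℝ) :=
  {x | v (x 1) < v (x 2) ∧ v (x 0) = v (x 2) ∨ v (x 2) < v (x 1) ∧ v (x 0) = v (x 1)}

/-- The largest value of a coordinate. -/
def supValue (x : Fin 3 → ℝ) : Γ := max (v (x 0)) (max (v (x 1)) (v (x 2)))

theorem disjoint_pingSet_pongSet : Disjoint (pingSet v) (pongSet v) := by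
  rw [Set.disjoint_left]
  rintro x ⟨h1, -⟩ (⟨h, -⟩ | ⟨h, -⟩)
  exacts [h.ne h1, h.ne' h1]

theorem supValue_of_mem_pingSet {x : Fin 3 → ℝ} (hx : x ∈ pingSet v) : supValue v x = v (x 1) := by
  obtain ⟨h1, h2⟩ := hx
  simp [supValue, ← h1, h2.le]

theorem supValue_of_mem_pongSet {x : Fin 3 → ℝ} (hx : x ∈ pongSet v) : supValue v x = v (x 0) := by
  rcases hx with ⟨h1, h2⟩ | ⟨h1, h2⟩ <;> simp [supValue, h2, h1.le]

/-- One of the last two coordinates strictly dominates the other, and `cos θ` and `sin θ` have equal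
value, so no cancellation occurs: both new coordinates have value `v (cos θ) * v (x 0)`. -/
theorem Rx_smul_pong {θ : ℝ} (hc : 1 < v (cos θ)) (hs : v (sin θ) = v (cos θ)) {x : Fin 3 → ℝ}
    (hx : x ∈ pongSet v) :
    Rx θ • x ∈ pingSet v ∧ supValue v x < supValue v (Rx θ • x) := by
  have hc0 : 0 < v (cos θ) := zero_lt_one.trans hc
  have key : v (cos θ * x 1 - sin θ * x 2) = v (cos θ) * v (x 0) ∧
      v (sin θ * x 1 + cos θ * x 2) = v (cos θ) * v (x 0) ∧ 0 < v (x 0) := by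
    rcases hx with ⟨h1, h2⟩ | ⟨h1, h2⟩
    · have : v (cos θ) * v (x 1) < v (cos θ) * v (x 2) := (mul_lt_mul_iff_right₀ hc0).2 h1
      refine ⟨?_, ?_, h2 ▸ zero_le.trans_lt h1⟩
      · rw [v.map_sub_eq_of_lt_right (by simpa [hs] using this), map_mul, hs, h2]
      · rw [v.map_add_eq_of_lt_right (by simpa [hs] using this), map_mul, h2]
    · have : v (cos θ) * v (x 2) < v (cos θ) * v (x 1) := (mul_lt_mul_iff_right₀ hc0).2 h1
      refine ⟨?_, ?_, h2 ▸ zero_le.trans_lt h1⟩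
      · rw [v.map_sub_eq_of_lt_left (by simpa [hs] using this), map_mul, h2]
      · rw [v.map_add_eq_of_lt_left (by simpa [hs] using this), map_mul, hs, h2]
  obtain ⟨k1, k2, k0⟩ := key
  have hlt : v (x 0) < v (cos θ) * v (x 0) := lt_mul_of_one_lt_left k0 hc
  have hP : Rx θ • x ∈ pingSet v := by
    rw [Rx_smul]
    exact ⟨k1.trans k2.symm, by simpa [k1] using hlt⟩
  refine ⟨hP, ?_⟩
  rw [supValue_of_mem_pingSet v hP, supValue_of_mem_pongSet v hx, Rx_smul]
  simpa [k1] using hlt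

theorem Ry_pi_div_two_sq_smul_ping {x : Fin 3 → ℝ} (hx : x ∈ pingSet v) :
    Ry (π / 2) ^ 2 • x ∈ pingSet v ∧ supValue v (Ry (π / 2) ^ 2 • x) = supValue v x := by
  simpa [Ry_pi_div_two_sq_smul, supValue, pingSet] using hx

/-- The quarter turn exchanges the first and last coordinates up to sign, so the small coordinate
becomes the last one. -/
theorem Ry_pi_div_two_smul_ping {x : Fin 3 → ℝ} (hx : x ∈ pingSet v) :
    Ry (π / 2) • x ∈ pongSet v ∧ supValue v (Ry (π / 2) • x) = supValue v x := by
  obtain ⟨h1, h2⟩ := hx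
  constructor
  · simp [Ry_pi_div_two_smul, pongSet, ← h1, h2]
  · simp [Ry_pi_div_two_smul, supValue, ← h1, h2.le]

theorem Rx_pi_div_two_smul_ping {x : Fin 3 → ℝ} (hx : x ∈ pingSet v) :
    Rx (π / 2) • x ∈ pingSet v ∧ supValue v (Rx (π / 2) • x) = supValue v x := by
  obtain ⟨h1, h2⟩ := hx
  constructor
  · simp [Rx_smul, pingSet, ← h1, h2]
  · simp [Rx_smul, supValue, ← h1]

theorem Rx_pi_div_two_smul_pong {x : Fin 3 → ℝ} (hx : x ∈ pongSet v) :
    Rx (π / 2) • x ∈ pongSet v ∧ supValue v (Rx (π / 2) • x) = supValue v x := by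
  constructor
  · simpa [Rx_smul, pongSet] using hx.symm
  · simp [Rx_smul, supValue, max_comm]

theorem dihedralX_four_smul_ping (a : DihedralGroup 4) {x : Fin 3 → ℝ} (hx : x ∈ pingSet v) :
    dihedralX 4 four_pos a • x ∈ pingSet v ∧
      supValue v (dihedralX 4 four_pos a • x) = supValue v x := by
  have hr (k : ℕ) : dihedralX 4 four_pos (.r 1) ^ k • x ∈ pingSet v ∧
      supValue v (dihedralX 4 four_pos (.r 1) ^ k • x) = supValue v x := by
    rw [dihedralX_r_one, two_pi_div_four]
    induction k with
    | zero => simpa using hx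
    | succ k ih =>
      rw [pow_succ', mul_smul]
      have := Rx_pi_div_two_smul_ping v ih.1
      exact ⟨this.1, this.2.trans ih.2⟩
  rcases a with a | a <;> obtain ⟨k, rfl⟩ := ZMod.natCast_zmod_surjective a
  · rw [← DihedralGroup.r_one_pow, map_pow]
    exact hr k
  · have : DihedralGroup.sr (k : ZMod 4) = .sr 0 * .r 1 ^ k := by simp
    rw [this, map_mul, map_pow, mul_smul, dihedralX_sr_zero]
    have := Ry_pi_div_two_sq_smul_ping v (hr k).1
    exact ⟨this.1, this.2.trans (hr k).2⟩

/-- Outside the dihedral group only two cosets remain, represented by `Ry (π / 2)` and `Rx (π / 2) *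
Ry (π / 2)`; the dihedral factor preserves `pingSet`, and the extra quarter turn about the `x`-axis
preserves `pongSet`. -/
theorem Ghat_four_four_smul_ping {g : SO3} (hg : g ∈ Ghat 4 4)
    (hgD : g ∉ (dihedralX 4 four_pos).range) {x : Fin 3 → ℝ} (hx : x ∈ pingSet v) :
    g • x ∈ pongSet v ∧ supValue v (g • x) = supValue v x := by
  obtain ⟨h, hgh⟩ := mem_Ghat_four_four hg
  have hd := dihedralX_four_smul_ping v h hx
  have hy := Ry_pi_div_two_smul_ping v hd.1
  rcases hgh with rfl | rfl | rfl
  · exact absurd ⟨h, rfl⟩ hgD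
  · rw [mul_smul]
    exact ⟨hy.1, hy.2.trans hd.2⟩
  · rw [mul_smul, mul_smul]
    have := Rx_pi_div_two_smul_pong v hy.1
    exact ⟨this.1, this.2.trans (hy.2.trans hd.2)⟩

end PingPong

/-! ### From ping-pong to the amalgam and its presentation. -/

/-- The criterion for `Ghat m 4` to be the amalgamated product of the dihedral group that fixes the
`x`-axis and a group `B` of symmetries of the cube. -/
theorem exists_amalgam_equiv_Ghat {m : ℕ} (hm : 0 < m) {H B : Type} [Group H] [Group B]
    {i : H →* DihedralGroup m} {j : H →* B} (f : B →* SO3)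
    (hij : (dihedralX m hm).comp i = f.comp j) (hi : Function.Injective i)
    (hsr : .sr 0 ∈ i.range) (hr : ∀ k : ℤ, (m : ℤ) ∣ 4 * k → .r (k : ZMod m) ∈ i.range)
    (hf : ∀ b, f b ∈ Ghat 4 4) (hfm : ∀ b, f b ∈ Ghat m 4)
    (hfD : ∀ b, f b ∈ (dihedralX 4 four_pos).range → b ∈ j.range)
    (hfS : Ry (π / 2) ∈ f.range) :
    ∃ e : Amalgam i j ≃* Ghat m 4,
      (∀ a, (e (Amalgam.inl i j a) : SO3) = dihedralX m hm a) ∧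
      ∀ b, (e (Amalgam.inr i j b) : SO3) = f b := by
  obtain ⟨Γ, _, v, hv⟩ := exists_valuation_cos_sin
  let F := Amalgam.lift (dihedralX m hm) f hij
  have hA (k : ℤ) (hk : .r (k : ZMod m) ∉ i.range) {x : Fin 3 → ℝ} (hx : x ∈ pongSet v) :=
    have h := hv m k (k * (2 * π / m)) hm (by field_simp) fun h => hk (hr k h)
    Rx_smul_pong v h.1 h.2 hx
  have hF : Function.Injective F := by
    refine Amalgam.lift_injective_of_ping_pong F ?_ (pingSet v) (pongSet v) (supValue v)
      (disjoint_pingSet_pongSet v) ⟨![0, 1, 1], by simp [pingSet]⟩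
      ⟨![1, 1, 0], by simp [pongSet]⟩ ?_ ?_
    · simp only [F, Amalgam.lift_inl]
      exact (dihedralX_injective hm).comp hi
    · rintro (a | a) ha x hx <;> obtain ⟨k, rfl⟩ := ZMod.intCast_surjective a
      · simp only [F, Amalgam.lift_inl, dihedralX_r]
        exact hA k ha hx
      · simp only [F, Amalgam.lift_inl, dihedralX_sr, mul_smul]
        -- `sr k` is `sr 0 * r k` and `sr 0` lies in the image of `H`, so `r k` is outside that
        -- image; the remaining half turn preserves `pingSet` and the size.
        have hk : .r (k : ZMod m) ∉ i.range := fun h => ha <| by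
          simpa using mul_mem hsr h
        have h1 := hA k hk hx
        have h2 := Ry_pi_div_two_sq_smul_ping v h1.1
        exact ⟨h2.1, h2.2 ▸ h1.2⟩
    · intro b hb x hx
      simp only [F, Amalgam.lift_inr]
      have := Ghat_four_four_smul_ping v (hf b) (fun h => hb (hfD b h)) hx
      exact ⟨this.1, this.2.ge⟩
  have hrange : F.range = Ghat m 4 := by
    apply le_antisymm
    · exact Amalgam.lift_range_le _ _ _ (dihedralX_mem_Ghat hm) hfm
    · rw [Ghat_eq_closure, Subgroup.closure_le]
      rintro _ (rfl | rfl)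
      · exact ⟨Amalgam.inl i j (.r 1), by simp only [F, Amalgam.lift_inl, dihedralX_r_one]⟩
      · obtain ⟨b, hb⟩ := hfS
        exact ⟨Amalgam.inr i j b, by simp only [F, Amalgam.lift_inr, hb]⟩
  exact ⟨(MonoidHom.ofInjective hF).trans (MulEquiv.subgroupCongr hrange),
    fun a => Amalgam.lift_inl (dihedralX m hm) f hij a,
    fun b => Amalgam.lift_inr (dihedralX m hm) f hij b⟩

/-- A presentation of `Ghat m 4` from a decomposition as an amalgamated product of which the
factors map compatibly to the presented group. -/
theorem hasPresentation_Ghat_of_amalgam {m : ℕ} {hm : 0 < m} {H B : Type} [Group H] [Group B]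
    {i : H →* DihedralGroup m} {j : H →* B} {f : B →* SO3} (e : Amalgam i j ≃* Ghat m 4)
    (hel : ∀ a, (e (Amalgam.inl i j a) : SO3) = dihedralX m hm a)
    (her : ∀ b, (e (Amalgam.inr i j b) : SO3) = f b) {rels : Set (FreeGroup (Fin 2))}
    (hrels : ∀ r ∈ rels, FreeGroup.lift ![Rx (2 * π / m), Ry (π / 2)] r = 1)
    (p : DihedralGroup m →* PresentedGroup rels) (q : B →* PresentedGroup rels)
    (hpq : p.comp i = q.comp j) (hp : p (.r 1) = .of 0) (b : B) (hb : f b = Ry (π / 2))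
    (hq : q b = .of 1) :
    HasPresentation (Ghat m 4) (Rx (2 * π / m)) (Ry (π / 2)) rels := by
  refine hasPresentation_of_hom (Ghat_eq_closure m) hrels
    ((Amalgam.lift p q hpq).comp e.symm.toMonoidHom) ?_ ?_
  · intro g hg
    have : e.symm g = Amalgam.inl i j (.r 1) := by
      rw [MulEquiv.symm_apply_eq]
      apply Subtype.ext
      rw [hg, hel, dihedralX_r_one]
    change Amalgam.lift p q hpq (e.symm g) = _
    rw [this, Amalgam.lift_inl, hp]
  · intro g hg
    have : e.symm g = Amalgam.inr i j b := by
      rw [MulEquiv.symm_apply_eq]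
      apply Subtype.ext
      rw [hg, her, hb]
    change Amalgam.lift p q hpq (e.symm g) = _
    rw [this, Amalgam.lift_inr, hq]

theorem lift_genA {G : Type*} [Group G] (a b : G) : FreeGroup.lift ![a, b] genA = a := by
  simp [genA]

theorem lift_genB {G : Type*} [Group G] (a b : G) : FreeGroup.lift ![a, b] genB = b := by
  simp [genB]

theorem PresentedGroup.hom_eq_one {rels : Set (FreeGroup (Fin 2))} {r : FreeGroup (Fin 2)}
    (h : r ∈ rels) :
    FreeGroup.lift ![PresentedGroup.of (rels := rels) 0, .of 1] r = 1 := by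
  have : FreeGroup.lift ![PresentedGroup.of (rels := rels) 0, .of 1] = PresentedGroup.mk rels := by
    ext t
    fin_cases t <;> simp <;> rfl
  rw [this]
  exact PresentedGroup.one_of_mem h

/-! ### The amalgamated subgroups and the factors inside the cube group. -/

namespace DihedralGroup

/-- The homomorphism `DihedralGroup d →* DihedralGroup m`, for a divisor `d` of `m`, that sends
`r 1` to `r (m / d)` and fixes the reflection `sr 0`. -/
def ofDvd {d m : ℕ} (h : d ∣ m) : DihedralGroup d →* DihedralGroup m :=
  lift d (r 1 ^ (m / d)) (sr 0) (by rw [← pow_mul, Nat.div_mul_cancel h, r_one_pow_n])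
    (by simp [sq]) (by simp)

variable {d m : ℕ} (h : d ∣ m)

theorem ofDvd_r_one : ofDvd h (r 1) = r 1 ^ (m / d) := lift_r_one ..

theorem ofDvd_sr_zero : ofDvd h (sr 0) = sr 0 := lift_sr_zero ..

theorem sr_zero_mem_range_ofDvd : sr 0 ∈ (ofDvd h).range := ⟨sr 0, ofDvd_sr_zero h⟩

theorem r_mem_range_ofDvd {k : ℤ} (hk : ((m / d : ℕ) : ℤ) ∣ k) :
    r (k : ZMod m) ∈ (ofDvd h).range := by
  obtain ⟨l, rfl⟩ := hk
  refine ⟨r 1 ^ l, ?_⟩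
  rw [map_zpow, ofDvd_r_one, ← r_one_zpow, zpow_mul, zpow_natCast]

end DihedralGroup

theorem dihedralX_comp_ofDvd {d m : ℕ} (hd : 0 < d) (hm : 0 < m) (h : d ∣ m) :
    (dihedralX m hm).comp (DihedralGroup.ofDvd h) = dihedralX d hd := by
  apply DihedralGroup.hom_ext
  · simp only [MonoidHom.comp_apply, DihedralGroup.ofDvd_r_one, map_pow, dihedralX_r_one,
      Rx_two_pi_div_pow_div hm h]
  · simp only [MonoidHom.comp_apply, DihedralGroup.ofDvd_sr_zero, dihedralX_sr_zero]

/-- Followed by the embedding of the larger group in `SO3`, the map is the embedding of the smaller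
one. -/
theorem DihedralGroup.ofDvd_injective {d m : ℕ} (hd : 0 < d) (hm : 0 < m) (h : d ∣ m) :
    Function.Injective (DihedralGroup.ofDvd h) := by
  have := dihedralX_injective hd
  rw [← dihedralX_comp_ofDvd hd hm h, MonoidHom.coe_comp] at this
  exact Function.Injective.of_comp this

/-- An odd number of quarter turns about the `y`-axis makes this entry 0. With
`dihedralX_apply_zero_zero_sq`, it bounds the intersection of `B` with the dihedral group about the
`x`-axis. -/
theorem even_of_Ry_pi_div_two_zpow {k : ℤ} (h : (Ry (π / 2) ^ k).1 0 0 ^ 2 = 1) : Even k := by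
  by_contra ho
  obtain ⟨l, rfl⟩ := Int.not_even_iff_odd.1 ho
  have h0 : cos (((2 * l + 1 : ℤ) : ℝ) * (π / 2)) = 0 := by
    rw [cos_eq_zero_iff]
    exact ⟨l, by push_cast; ring⟩
  rw [Ry_zpow] at h
  simp only [Ry, rotMatY, h0] at h
  simp at h

theorem Rx_two_pi_div_two : Rx (2 * π / (2 : ℕ)) = Rx π := by
  congr 1
  push_cast
  ring

theorem Rx_pi_sq : Rx π ^ 2 = 1 := by
  rw [← Rx_two_pi_div_two, Rx_two_pi_div_pow two_pos]

theorem Rx_pi_mem_Ghat {m : ℕ} (hm : 0 < m) (h : 2 ∣ m) : Rx π ∈ Ghat m 4 := by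
  rw [← Rx_two_pi_div_two, ← Rx_two_pi_div_pow_div hm h]
  exact pow_mem (Rx_two_pi_div_mem_Ghat m) _

/-- The dihedral subgroup of `SO(3)` generated by the quarter turn about the `y`-axis and the half
turn about the `x`-axis. -/
noncomputable def dihedralY : DihedralGroup 4 →* SO3 :=
  DihedralGroup.lift 4 (Ry (π / 2)) (Rx π) Ry_pi_div_two_pow_four Rx_pi_sq
    (conj_eq_inv_of_sq_eq_one Rx_pi_sq (Rx_pi_mul_Ry_sq _))

theorem even_of_dihedralY_mem {k : ℤ}
    (h : dihedralY (.r k) ∈ (dihedralX 4 four_pos).range ∨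
      dihedralY (.sr k) ∈ (dihedralX 4 four_pos).range) : Even k := by
  apply even_of_Ry_pi_div_two_zpow
  rcases h with ⟨a, ha⟩ | ⟨a, ha⟩
  · rw [dihedralY, DihedralGroup.lift_r_intCast] at ha
    rw [← ha, dihedralX_apply_zero_zero_sq]
  · rw [dihedralY, DihedralGroup.lift_sr_intCast] at ha
    rw [← dihedralX_apply_zero_zero_sq four_pos a, ha]
    simp [Rx, rotMatX, Matrix.mul_apply, Fin.sum_univ_three]

/-- The half turns about the coordinate axes inside the dihedral group `dihedralY`. -/
def kleinToDihedral : DihedralGroup 2 →* DihedralGroup 4 :=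
  DihedralGroup.lift 2 (.sr 0) (.r 1 ^ 2) (by decide) (by decide) (by decide)

theorem kleinToDihedral_r_one : kleinToDihedral (.r 1) = .sr 0 := DihedralGroup.lift_r_one ..

theorem kleinToDihedral_sr_zero : kleinToDihedral (.sr 0) = .r 1 ^ 2 :=
  DihedralGroup.lift_sr_zero ..

theorem mem_range_kleinToDihedral {b : DihedralGroup 4}
    (h : dihedralY b ∈ (dihedralX 4 four_pos).range) : b ∈ kleinToDihedral.range := by
  have hr (l : ℤ) : .r ((l + l : ℤ) : ZMod 4) ∈ kleinToDihedral.range := by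
    refine ⟨.sr 0 ^ l, ?_⟩
    rw [map_zpow, kleinToDihedral_sr_zero, ← DihedralGroup.r_one_zpow, ← two_mul, zpow_mul,
      zpow_ofNat]
  rcases b with a | a <;> obtain ⟨k, rfl⟩ := ZMod.intCast_surjective a
  · obtain ⟨l, rfl⟩ := even_of_dihedralY_mem (.inl h)
    exact hr l
  · obtain ⟨l, rfl⟩ := even_of_dihedralY_mem (.inr h)
    have : DihedralGroup.sr ((l + l : ℤ) : ZMod 4) = .sr 0 * .r ((l + l : ℤ) : ZMod 4) := by simp
    rw [this]
    exact mul_mem ⟨.r 1, kleinToDihedral_r_one⟩ (hr l)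

theorem mem_range_of_cyclicLift_mem {a : Multiplicative (ZMod 4)}
    (h : cyclicLift 4 _ Ry_pi_div_two_pow_four a ∈ (dihedralX 4 four_pos).range) :
    a ∈ (cyclicLift 2 (Multiplicative.ofAdd (2 : ZMod 4)) (by decide)).range := by
  obtain ⟨a, rfl⟩ := Multiplicative.ofAdd.surjective a
  obtain ⟨k, rfl⟩ := ZMod.intCast_surjective a
  obtain ⟨a, ha⟩ := h
  rw [cyclicLift_intCast] at ha
  obtain ⟨l, rfl⟩ : Even k := by
    apply even_of_Ry_pi_div_two_zpow
    rw [← ha, dihedralX_apply_zero_zero_sq]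
  refine ⟨Multiplicative.ofAdd (l : ZMod 2), ?_⟩
  rw [cyclicLift_intCast, ← ofAdd_zsmul]
  congr 1
  rw [zsmul_eq_mul]
  push_cast
  ring

theorem injective_cyclicLift_sr_zero (m : ℕ) (h : DihedralGroup.sr (0 : ZMod m) ^ 2 = 1) :
    Function.Injective (cyclicLift 2 (DihedralGroup.sr (0 : ZMod m)) h) := by
  rw [injective_iff_map_eq_one]
  intro a ha
  obtain ⟨a, rfl⟩ := Multiplicative.ofAdd.surjective a
  fin_cases a
  · rfl
  · have := cyclicLift_one 2 (DihedralGroup.sr (0 : ZMod m)) h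
    rw [DihedralGroup.one_def] at ha
    exact absurd (this.symm.trans ha) (by simp only [reduceCtorEq, not_false_iff])

/-! ### The presentation of the cube group. -/

/-- The presentation of the rotation group of the cube. -/
theorem hasPresentation_Ghat_four_four :
    HasPresentation (Ghat 4 4) (Rx (π / 2)) (Ry (π / 2))
      {genA ^ 4, genB ^ 4, (genA * genB ^ 2) ^ 2, (genA ^ 2 * genB) ^ 2, (genA * genB) ^ 3} := by
  set rels : Set (FreeGroup (Fin 2)) :=
    {genA ^ 4, genB ^ 4, (genA * genB ^ 2) ^ 2, (genA ^ 2 * genB) ^ 2, (genA * genB) ^ 3} with hrel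
  have hrels : ∀ r ∈ rels, FreeGroup.lift ![Rx (π / 2), Ry (π / 2)] r = 1 := by
    simp only [hrel, Set.mem_insert_iff, Set.mem_singleton_iff, forall_eq_or_imp, forall_eq]
    simp only [map_mul, map_pow, lift_genA, lift_genB, Rx_pi_div_two_sq]
    exact ⟨Rx_pi_div_two_pow_four, Ry_pi_div_two_pow_four, Rx_mul_Ry_pi_div_two_sq_sq _,
      Rx_pi_mul_Ry_sq _, Rx_mul_Ry_pi_div_two_pow_three⟩
  have hG : Ghat 4 4 = Subgroup.closure {Rx (π / 2), Ry (π / 2)} := by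
    rw [Ghat_eq_closure, two_pi_div_four]
  apply hasPresentation_of_injective hG hrels
  obtain ⟨ha, hb, hab2, ha2b, hab⟩ :
      PresentedGroup.of (rels := rels) 0 ^ 4 = 1 ∧ PresentedGroup.of (rels := rels) 1 ^ 4 = 1 ∧
      (PresentedGroup.of (rels := rels) 0 * .of 1 ^ 2) ^ 2 = 1 ∧
      (PresentedGroup.of (rels := rels) 0 ^ 2 * .of 1) ^ 2 = 1 ∧
      (PresentedGroup.of (rels := rels) 0 * .of 1) ^ 3 = 1 := by
    have h := fun r hr => PresentedGroup.hom_eq_one (rels := rels) (r := r) hr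
    simpa only [hrel, Set.mem_insert_iff, Set.mem_singleton_iff, forall_eq_or_imp, forall_eq,
      map_mul, map_pow, lift_genA, lift_genB] using h
  have hb2 : (PresentedGroup.of (rels := rels) 1 ^ 2) ^ 2 = 1 := by rw [← pow_mul, hb]
  let d := DihedralGroup.lift 4 (PresentedGroup.of (rels := rels) 0)
    (PresentedGroup.of (rels := rels) 1 ^ 2) ha hb2 (conj_eq_inv_of_sq_eq_one' hb2 hab2)
  have hd : (PresentedGroup.toGroup hrels).comp d = dihedralX 4 four_pos := by
    apply DihedralGroup.hom_ext
    · rw [MonoidHom.comp_apply, DihedralGroup.lift_r_one, dihedralX_r_one, two_pi_div_four]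
      exact PresentedGroup.toGroup.of hrels
    · rw [MonoidHom.comp_apply, DihedralGroup.lift_sr_zero, dihedralX_sr_zero, map_pow]
      exact congrArg (· ^ 2) (PresentedGroup.toGroup.of hrels)
  have hd' (h) : PresentedGroup.toGroup hrels (d h) = dihedralX 4 four_pos h :=
    DFunLike.congr_fun hd h
  -- This rules out the two nontrivial cosets: their representatives have upper left entry 0, while
  -- dihedral elements have `±1` there.
  have hne (g : SO3) (hg : g.1 0 0 = 0) (h) : g * dihedralX 4 four_pos h ≠ 1 := by
    intro h1
    rw [mul_eq_one_iff_eq_inv, ← map_inv] at h1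
    have := dihedralX_apply_zero_zero_sq four_pos h⁻¹
    rw [← h1, hg] at this
    norm_num at this
  rw [injective_iff_map_eq_one]
  intro g hg
  have hmem : g ∈ Subgroup.closure {PresentedGroup.of (rels := rels) 0, .of 1} := by
    refine PresentedGroup.generated_by rels _ (fun t => ?_) g
    fin_cases t <;> exact Subgroup.subset_closure (by simp)
  obtain ⟨h, rfl | rfl | rfl⟩ := mem_cosets_of_mem_closure ha hb ha2b hab d
    (DihedralGroup.lift_r_one ..) (DihedralGroup.lift_sr_zero ..) hmem
  · rw [hd', ← map_one (dihedralX 4 four_pos)] at hg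
    rw [dihedralX_injective four_pos hg, map_one]
  · rw [map_mul, hd', PresentedGroup.toGroup.of] at hg
    exact absurd hg (hne _ (by simp [Ry, rotMatY]) h)
  · rw [map_mul, map_mul, hd', PresentedGroup.toGroup.of, PresentedGroup.toGroup.of] at hg
    exact absurd hg (hne _ (by simp [Rx, rotMatX, Ry, rotMatY]) h)

/-! ### The three cases. -/

theorem Ghat_of_odd {m : ℕ} (hm : 0 < m) (ho : Odd m) :
    HasPresentation (Ghat m 4) (Rx (2 * π / m)) (Ry (π / 2))
      {genA ^ m, genB ^ 4, (genA * genB ^ 2) ^ 2} ∧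
    ∃ (i : Multiplicative (ZMod 2) →* DihedralGroup m)
      (j : Multiplicative (ZMod 2) →* Multiplicative (ZMod 4)),
      Function.Injective i ∧ Function.Injective j ∧
      i (Multiplicative.ofAdd 1) = DihedralGroup.sr 0 ∧
      j (Multiplicative.ofAdd 1) = Multiplicative.ofAdd 2 ∧
      ∃ e : Amalgam i j ≃* Ghat m 4,
        (e (Amalgam.inl i j (DihedralGroup.r 1)) : SO3) = Rx (2 * π / m) ∧
        (e (Amalgam.inl i j (DihedralGroup.sr 0)) : SO3) = Ry (π / 2) ^ 2 ∧
        (e (Amalgam.inr i j (Multiplicative.ofAdd 1)) : SO3) = Ry (π / 2) := by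
  set rels : Set (FreeGroup (Fin 2)) := {genA ^ m, genB ^ 4, (genA * genB ^ 2) ^ 2} with hrel
  let i := cyclicLift 2 (DihedralGroup.sr (0 : ZMod m)) (by simp [sq])
  let j := cyclicLift 2 (Multiplicative.ofAdd (2 : ZMod 4)) (by decide)
  let f := cyclicLift 4 (Ry (π / 2)) Ry_pi_div_two_pow_four
  have hi1 : i (Multiplicative.ofAdd 1) = .sr 0 := cyclicLift_one ..
  have hj1 : j (Multiplicative.ofAdd 1) = Multiplicative.ofAdd 2 := cyclicLift_one ..
  have hj2 : Multiplicative.ofAdd (2 : ZMod 4) = Multiplicative.ofAdd 1 ^ 2 := by decide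
  have hf1 : f (Multiplicative.ofAdd 1) = Ry (π / 2) := cyclicLift_one ..
  have hi : Function.Injective i := injective_cyclicLift_sr_zero m _
  have hij : (dihedralX m hm).comp i = f.comp j := by
    apply cyclicHom_ext
    simp only [MonoidHom.comp_apply]
    rw [hi1, hj1, hj2, map_pow, hf1, dihedralX_sr_zero]
  have hfmem (n : ℕ) (b) : f b ∈ Ghat n 4 := by
    obtain ⟨a, rfl⟩ := Multiplicative.ofAdd.surjective b
    obtain ⟨k, rfl⟩ := ZMod.intCast_surjective a
    simp only [f, cyclicLift_intCast]
    exact zpow_mem (Ry_pi_div_two_mem_Ghat n) k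
  obtain ⟨e, hel, her⟩ := exists_amalgam_equiv_Ghat hm (j := j) f hij hi ⟨_, hi1⟩
    (fun k hk => by
      -- As `m` is coprime to 4, the only rotation in `D_m` by a multiple of `π / 2` is the
      -- identity.
      have hco : IsCoprime (m : ℤ) 4 := by
        rw [Int.isCoprime_iff_gcd_eq_one]
        exact (Nat.Coprime.pow_right 2 (Nat.coprime_two_right.2 ho) : Nat.Coprime m (2 ^ 2))
      rw [(ZMod.intCast_zmod_eq_zero_iff_dvd k m).2 (hco.dvd_of_dvd_mul_left hk)]
      exact one_mem _)
    (hfmem 4) (hfmem m) (fun b => mem_range_of_cyclicLift_mem) ⟨_, hf1⟩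
  refine ⟨?_, i, j, hi, ?_, hi1, hj1, e, ?_, ?_, ?_⟩
  · have hrels : ∀ r ∈ rels, FreeGroup.lift ![Rx (2 * π / m), Ry (π / 2)] r = 1 := by
      simp only [hrel, Set.mem_insert_iff, Set.mem_singleton_iff, forall_eq_or_imp, forall_eq,
        map_mul, map_pow, lift_genA, lift_genB]
      exact ⟨Rx_two_pi_div_pow hm, Ry_pi_div_two_pow_four, Rx_mul_Ry_pi_div_two_sq_sq _⟩
    obtain ⟨ha, hb, hab⟩ :
        PresentedGroup.of (rels := rels) 0 ^ m = 1 ∧ PresentedGroup.of (rels := rels) 1 ^ 4 = 1 ∧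
        (PresentedGroup.of (rels := rels) 0 * .of 1 ^ 2) ^ 2 = 1 := by
      have h := fun r hr => PresentedGroup.hom_eq_one (rels := rels) (r := r) hr
      simpa only [hrel, Set.mem_insert_iff, Set.mem_singleton_iff, forall_eq_or_imp, forall_eq,
        map_mul, map_pow, lift_genA, lift_genB] using h
    have hb2 : (PresentedGroup.of (rels := rels) 1 ^ 2) ^ 2 = 1 := by rw [← pow_mul, hb]
    refine hasPresentation_Ghat_of_amalgam e hel her hrels
      (DihedralGroup.lift m _ _ ha hb2 (conj_eq_inv_of_sq_eq_one' hb2 hab))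
      (cyclicLift 4 _ hb) ?_ (DihedralGroup.lift_r_one ..) _ hf1 (cyclicLift_one ..)
    apply cyclicHom_ext
    simp only [MonoidHom.comp_apply]
    rw [hi1, hj1, hj2, map_pow, DihedralGroup.lift_sr_zero, cyclicLift_one]
  -- Injectivity of `j` comes from the commuting square, whose other side is a composite of
  -- injections.
  · have := (dihedralX_injective hm).comp hi
    rw [← MonoidHom.coe_comp, hij, MonoidHom.coe_comp] at this
    exact this.of_comp
  · rw [hel, dihedralX_r_one]
  · rw [hel, dihedralX_sr_zero]
  · rw [her, hf1]

theorem Ghat_of_two_mul_odd {m k : ℕ} (hm : 0 < m) (ho : Odd k) (hmk : m = 2 * k) :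
    HasPresentation (Ghat m 4) (Rx (2 * π / m)) (Ry (π / 2))
      {genA ^ m, genB ^ 4, (genA * genB ^ 2) ^ 2, (genA ^ (m / 2) * genB) ^ 2} ∧
    ∃ (i : DihedralGroup 2 →* DihedralGroup m) (j : DihedralGroup 2 →* DihedralGroup 4),
      Function.Injective i ∧ Function.Injective j ∧
      i (DihedralGroup.r 1) = DihedralGroup.r 1 ^ (m / 2) ∧
      i (DihedralGroup.sr 0) = DihedralGroup.sr 0 ∧
      j (DihedralGroup.r 1) = DihedralGroup.sr 0 ∧
      j (DihedralGroup.sr 0) = DihedralGroup.r 1 ^ 2 ∧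
      ∃ e : Amalgam i j ≃* Ghat m 4,
        (e (Amalgam.inl i j (DihedralGroup.r 1)) : SO3) = Rx (2 * π / m) ∧
        (e (Amalgam.inl i j (DihedralGroup.sr 0)) : SO3) = Ry (π / 2) ^ 2 ∧
        (e (Amalgam.inr i j (DihedralGroup.r 1)) : SO3) = Ry (π / 2) ∧
        (e (Amalgam.inr i j (DihedralGroup.sr 0)) : SO3) = Rx (2 * π / m) ^ (m / 2) := by
  have h2 : 2 ∣ m := ⟨k, hmk⟩
  have hTm : Rx (2 * π / m) ^ (m / 2) = Rx π := by
    rw [Rx_two_pi_div_pow_div hm h2, Rx_two_pi_div_two]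
  set rels : Set (FreeGroup (Fin 2)) :=
    {genA ^ m, genB ^ 4, (genA * genB ^ 2) ^ 2, (genA ^ (m / 2) * genB) ^ 2} with hrel
  have hi := DihedralGroup.ofDvd_injective two_pos hm h2
  have hf1 : dihedralY (.r 1) = Ry (π / 2) := DihedralGroup.lift_r_one ..
  have hf2 : dihedralY (.sr 0) = Rx π := DihedralGroup.lift_sr_zero ..
  have hij : (dihedralX m hm).comp (DihedralGroup.ofDvd h2) = dihedralY.comp kleinToDihedral := by
    apply DihedralGroup.hom_ext
    · simp only [MonoidHom.comp_apply]
      rw [DihedralGroup.ofDvd_r_one, map_pow, dihedralX_r_one, hTm, kleinToDihedral_r_one, hf2]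
    · simp only [MonoidHom.comp_apply]
      rw [DihedralGroup.ofDvd_sr_zero, dihedralX_sr_zero, kleinToDihedral_sr_zero, map_pow, hf1]
  have hfmem {n : ℕ} (hn : 0 < n) (h : 2 ∣ n) (b) : dihedralY b ∈ Ghat n 4 :=
    DihedralGroup.lift_mem _ _ _ _ _ _ (Ry_pi_div_two_mem_Ghat n) (Rx_pi_mem_Ghat hn h) b
  obtain ⟨e, hel, her⟩ := exists_amalgam_equiv_Ghat hm dihedralY hij hi
    (DihedralGroup.sr_zero_mem_range_ofDvd h2)
    (fun l hl => by
      apply DihedralGroup.r_mem_range_ofDvd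
      have hco : IsCoprime (k : ℤ) 2 := by
        rw [Int.isCoprime_iff_gcd_eq_one]
        exact Nat.coprime_two_right.2 ho
      rw [hmk, Nat.mul_div_cancel_left _ two_pos]
      apply hco.dvd_of_dvd_mul_left
      rw [hmk] at hl
      obtain ⟨c, hc⟩ := hl
      exact ⟨c, by push_cast at hc; linarith⟩)
    (hfmem four_pos (by norm_num)) (hfmem hm h2) (fun b => mem_range_kleinToDihedral) ⟨_, hf1⟩
  refine ⟨?_, DihedralGroup.ofDvd h2, kleinToDihedral, hi, ?_, DihedralGroup.ofDvd_r_one h2,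
    DihedralGroup.ofDvd_sr_zero h2, kleinToDihedral_r_one, kleinToDihedral_sr_zero, e,
    ?_, ?_, ?_, ?_⟩
  · have hrels : ∀ r ∈ rels, FreeGroup.lift ![Rx (2 * π / m), Ry (π / 2)] r = 1 := by
      simp only [hrel, Set.mem_insert_iff, Set.mem_singleton_iff, forall_eq_or_imp, forall_eq,
        map_mul, map_pow, lift_genA, lift_genB, hTm]
      exact ⟨Rx_two_pi_div_pow hm, Ry_pi_div_two_pow_four, Rx_mul_Ry_pi_div_two_sq_sq _,
        Rx_pi_mul_Ry_sq _⟩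
    obtain ⟨ha, hb, hab, hamb⟩ :
        PresentedGroup.of (rels := rels) 0 ^ m = 1 ∧ PresentedGroup.of (rels := rels) 1 ^ 4 = 1 ∧
        (PresentedGroup.of (rels := rels) 0 * .of 1 ^ 2) ^ 2 = 1 ∧
        (PresentedGroup.of (rels := rels) 0 ^ (m / 2) * .of 1) ^ 2 = 1 := by
      have h := fun r hr => PresentedGroup.hom_eq_one (rels := rels) (r := r) hr
      simpa only [hrel, Set.mem_insert_iff, Set.mem_singleton_iff, forall_eq_or_imp, forall_eq,
        map_mul, map_pow, lift_genA, lift_genB] using h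
    have hb2 : (PresentedGroup.of (rels := rels) 1 ^ 2) ^ 2 = 1 := by rw [← pow_mul, hb]
    have ham : (PresentedGroup.of (rels := rels) 0 ^ (m / 2)) ^ 2 = 1 := by
      rw [← pow_mul, Nat.div_mul_cancel h2, ha]
    refine hasPresentation_Ghat_of_amalgam e hel her hrels
      (DihedralGroup.lift m _ _ ha hb2 (conj_eq_inv_of_sq_eq_one' hb2 hab))
      (DihedralGroup.lift 4 _ _ hb ham (conj_eq_inv_of_sq_eq_one ham hamb))
      ?_ (DihedralGroup.lift_r_one ..) _ hf1 (DihedralGroup.lift_r_one ..)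
    apply DihedralGroup.hom_ext
    · simp only [MonoidHom.comp_apply]
      rw [DihedralGroup.ofDvd_r_one, map_pow, kleinToDihedral_r_one, DihedralGroup.lift_r_one,
        DihedralGroup.lift_sr_zero]
    · simp only [MonoidHom.comp_apply]
      rw [DihedralGroup.ofDvd_sr_zero, kleinToDihedral_sr_zero, map_pow, DihedralGroup.lift_r_one,
        DihedralGroup.lift_sr_zero]
  · have := (dihedralX_injective hm).comp hi
    rw [← MonoidHom.coe_comp, hij, MonoidHom.coe_comp] at this
    exact this.of_comp
  · rw [hel, dihedralX_r_one]
  · rw [hel, dihedralX_sr_zero]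
  · rw [her, hf1]
  · rw [her, hf2, hTm]

theorem Ghat_of_four_dvd {m : ℕ} (hm : 0 < m) (h4 : 4 ∣ m) :
    HasPresentation (Ghat m 4) (Rx (2 * π / m)) (Ry (π / 2))
      {genA ^ m, genB ^ 4, (genA * genB ^ 2) ^ 2, (genA ^ (m / 2) * genB) ^ 2,
        (genA ^ (m / 4) * genB) ^ 3} ∧
    ∃ (i : DihedralGroup 4 →* DihedralGroup m) (j : DihedralGroup 4 →* Ghat 4 4),
      Function.Injective i ∧ Function.Injective j ∧
      i (DihedralGroup.r 1) = DihedralGroup.r 1 ^ (m / 4) ∧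
      i (DihedralGroup.sr 0) = DihedralGroup.sr 0 ∧
      (j (DihedralGroup.r 1) : SO3) = Rx (π / 2) ∧
      (j (DihedralGroup.sr 0) : SO3) = Ry (π / 2) ^ 2 ∧
      ∃ e : Amalgam i j ≃* Ghat m 4,
        (e (Amalgam.inl i j (DihedralGroup.r 1)) : SO3) = Rx (2 * π / m) ∧
        (e (Amalgam.inl i j (DihedralGroup.sr 0)) : SO3) = Ry (π / 2) ^ 2 ∧
        ∀ g : Ghat 4 4, (e (Amalgam.inr i j g) : SO3) = g := by
  have h2 : 2 ∣ m := dvd_trans (by norm_num) h4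
  have hT2 : Rx (2 * π / m) ^ (m / 2) = Rx π := by
    rw [Rx_two_pi_div_pow_div hm h2, Rx_two_pi_div_two]
  have hT4 : Rx (2 * π / m) ^ (m / 4) = Rx (π / 2) := by
    rw [Rx_two_pi_div_pow_div hm h4, two_pi_div_four]
  set rels : Set (FreeGroup (Fin 2)) :=
    {genA ^ m, genB ^ 4, (genA * genB ^ 2) ^ 2, (genA ^ (m / 2) * genB) ^ 2,
      (genA ^ (m / 4) * genB) ^ 3} with hrel
  let j : DihedralGroup 4 →* Ghat 4 4 :=
    (dihedralX 4 four_pos).codRestrict (Ghat 4 4) (dihedralX_mem_Ghat four_pos)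
  have hj : (Ghat 4 4).subtype.comp j = dihedralX 4 four_pos := rfl
  have hj1 : (j (.r 1) : SO3) = Rx (π / 2) :=
    (dihedralX_r_one four_pos).trans (congrArg Rx two_pi_div_four)
  have hj2 : (j (.sr 0) : SO3) = Ry (π / 2) ^ 2 := dihedralX_sr_zero four_pos
  have hi := DihedralGroup.ofDvd_injective four_pos hm h4
  have hij : (dihedralX m hm).comp (DihedralGroup.ofDvd h4) = (Ghat 4 4).subtype.comp j := by
    rw [hj, dihedralX_comp_ofDvd four_pos hm h4]
  obtain ⟨e, hel, her⟩ := exists_amalgam_equiv_Ghat hm (Ghat 4 4).subtype hij hi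
    (DihedralGroup.sr_zero_mem_range_ofDvd h4)
    (fun k hk => by
      apply DihedralGroup.r_mem_range_ofDvd
      obtain ⟨n, rfl⟩ := h4
      rw [Nat.mul_div_cancel_left _ four_pos]
      push_cast at hk
      exact Int.dvd_of_mul_dvd_mul_left (by norm_num) hk)
    (fun b => b.2) (fun b => Ghat_four_four_le hm h4 b.2)
    (fun b ⟨a, ha⟩ => ⟨a, Subtype.ext ha⟩) ⟨⟨_, Ry_pi_div_two_mem_Ghat 4⟩, rfl⟩
  refine ⟨?_, DihedralGroup.ofDvd h4, j, hi, ?_, DihedralGroup.ofDvd_r_one h4,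
    DihedralGroup.ofDvd_sr_zero h4, hj1, hj2, e, ?_, ?_, her⟩
  · have hrels : ∀ r ∈ rels, FreeGroup.lift ![Rx (2 * π / m), Ry (π / 2)] r = 1 := by
      simp only [hrel, Set.mem_insert_iff, Set.mem_singleton_iff, forall_eq_or_imp, forall_eq,
        map_mul, map_pow, lift_genA, lift_genB, hT2, hT4]
      exact ⟨Rx_two_pi_div_pow hm, Ry_pi_div_two_pow_four, Rx_mul_Ry_pi_div_two_sq_sq _,
        Rx_pi_mul_Ry_sq _, Rx_mul_Ry_pi_div_two_pow_three⟩
    obtain ⟨ha, hb, hab, ha2, ha3⟩ :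
        PresentedGroup.of (rels := rels) 0 ^ m = 1 ∧ PresentedGroup.of (rels := rels) 1 ^ 4 = 1 ∧
        (PresentedGroup.of (rels := rels) 0 * .of 1 ^ 2) ^ 2 = 1 ∧
        (PresentedGroup.of (rels := rels) 0 ^ (m / 2) * .of 1) ^ 2 = 1 ∧
        (PresentedGroup.of (rels := rels) 0 ^ (m / 4) * .of 1) ^ 3 = 1 := by
      have h := fun r hr => PresentedGroup.hom_eq_one (rels := rels) (r := r) hr
      simpa only [hrel, Set.mem_insert_iff, Set.mem_singleton_iff, forall_eq_or_imp, forall_eq,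
        map_mul, map_pow, lift_genA, lift_genB] using h
    have hb2 : (PresentedGroup.of (rels := rels) 1 ^ 2) ^ 2 = 1 := by rw [← pow_mul, hb]
    let p := DihedralGroup.lift m _ _ ha hb2 (conj_eq_inv_of_sq_eq_one' hb2 hab)
    have hp1 : p (.r 1) = .of 0 := DihedralGroup.lift_r_one ..
    have hp2 : p (.sr 0) = .of 1 ^ 2 := DihedralGroup.lift_sr_zero ..
    set rels₄ : Set (FreeGroup (Fin 2)) :=
      {genA ^ 4, genB ^ 4, (genA * genB ^ 2) ^ 2, (genA ^ 2 * genB) ^ 2, (genA * genB) ^ 3}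
      with hrel₄
    have hpres : HasPresentation (Ghat 4 4) (Rx (π / 2)) (Ry (π / 2)) rels₄ :=
      hasPresentation_Ghat_four_four
    obtain ⟨e₄, he₄a, he₄b⟩ := hpres
    have hrels₄ : ∀ r ∈ rels₄,
        FreeGroup.lift ![PresentedGroup.of (rels := rels) 0 ^ (m / 4), .of 1] r = 1 := by
      simp only [hrel₄, Set.mem_insert_iff, Set.mem_singleton_iff, forall_eq_or_imp, forall_eq,
        map_mul, map_pow, lift_genA, lift_genB]
      refine ⟨by rw [← pow_mul, Nat.div_mul_cancel h4, ha], hb, ?_, ?_, ha3⟩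
      -- This relation is not among the relators; it holds because `r 1 ^ (m / 4) * sr 0` is a
      -- reflection in `D_m`, which `p` maps to the presented group.
      · rw [← hp1, ← hp2, ← map_pow, ← map_mul, ← map_pow, DihedralGroup.r_one_pow,
          DihedralGroup.r_mul_sr, sq, DihedralGroup.sr_mul_self, map_one]
      · rw [← pow_mul, show m / 4 * 2 = m / 2 by omega, ha2]
    let q : Ghat 4 4 →* PresentedGroup rels :=
      (PresentedGroup.toGroup hrels₄).comp e₄.symm.toMonoidHom
    have hqa (g : Ghat 4 4) (hg : (g : SO3) = Rx (π / 2)) : q g = .of 0 ^ (m / 4) := by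
      have : e₄.symm g = .of 0 := by
        rw [MulEquiv.symm_apply_eq]
        exact Subtype.ext (hg.trans he₄a.symm)
      change PresentedGroup.toGroup hrels₄ (e₄.symm g) = _
      rw [this]
      exact PresentedGroup.toGroup.of hrels₄
    have hqb (g : Ghat 4 4) (hg : (g : SO3) = Ry (π / 2)) : q g = .of 1 := by
      have : e₄.symm g = .of 1 := by
        rw [MulEquiv.symm_apply_eq]
        exact Subtype.ext (hg.trans he₄b.symm)
      change PresentedGroup.toGroup hrels₄ (e₄.symm g) = _
      rw [this]
      exact PresentedGroup.toGroup.of hrels₄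
    refine hasPresentation_Ghat_of_amalgam e hel her hrels p q ?_ hp1
      ⟨_, Ry_pi_div_two_mem_Ghat 4⟩ rfl (hqb _ rfl)
    apply DihedralGroup.hom_ext
    · simp only [MonoidHom.comp_apply]
      rw [DihedralGroup.ofDvd_r_one, map_pow, hp1, hqa _ hj1]
    · have : j (.sr 0) = ⟨_, Ry_pi_div_two_mem_Ghat 4⟩ ^ 2 := Subtype.ext hj2
      simp only [MonoidHom.comp_apply]
      rw [DihedralGroup.ofDvd_sr_zero, hp2, this, map_pow, hqb _ rfl]
  · exact fun a b hab => dihedralX_injective four_pos (congrArg Subtype.val hab)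
  · rw [hel, dihedralX_r_one]
  · rw [hel, dihedralX_sr_zero]

theorem theorem1 (m : ℕ) (hm : 0 < m) :
    (Odd m →
      HasPresentation (Ghat m 4) (Rx (2 * π / m)) (Ry (π / 2))
        {genA ^ m, genB ^ 4, (genA * genB ^ 2) ^ 2} ∧
      ∃ (i : Multiplicative (ZMod 2) →* DihedralGroup m)
        (j : Multiplicative (ZMod 2) →* Multiplicative (ZMod 4)),
        Function.Injective i ∧ Function.Injective j ∧
        i (Multiplicative.ofAdd 1) = DihedralGroup.sr 0 ∧
        j (Multiplicative.ofAdd 1) = Multiplicative.ofAdd 2 ∧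
        ∃ e : Amalgam i j ≃* Ghat m 4,
          (e (Amalgam.inl i j (DihedralGroup.r 1)) : SO3) = Rx (2 * π / m) ∧
          (e (Amalgam.inl i j (DihedralGroup.sr 0)) : SO3) = Ry (π / 2) ^ 2 ∧
          (e (Amalgam.inr i j (Multiplicative.ofAdd 1)) : SO3) = Ry (π / 2)) ∧
    ((∃ k : ℕ, Odd k ∧ m = 2 * k) →
      HasPresentation (Ghat m 4) (Rx (2 * π / m)) (Ry (π / 2))
        {genA ^ m, genB ^ 4, (genA * genB ^ 2) ^ 2, (genA ^ (m / 2) * genB) ^ 2} ∧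
      ∃ (i : DihedralGroup 2 →* DihedralGroup m) (j : DihedralGroup 2 →* DihedralGroup 4),
        Function.Injective i ∧ Function.Injective j ∧
        i (DihedralGroup.r 1) = DihedralGroup.r 1 ^ (m / 2) ∧
        i (DihedralGroup.sr 0) = DihedralGroup.sr 0 ∧
        j (DihedralGroup.r 1) = DihedralGroup.sr 0 ∧
        j (DihedralGroup.sr 0) = DihedralGroup.r 1 ^ 2 ∧
        ∃ e : Amalgam i j ≃* Ghat m 4,
          (e (Amalgam.inl i j (DihedralGroup.r 1)) : SO3) = Rx (2 * π / m) ∧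
          (e (Amalgam.inl i j (DihedralGroup.sr 0)) : SO3) = Ry (π / 2) ^ 2 ∧
          (e (Amalgam.inr i j (DihedralGroup.r 1)) : SO3) = Ry (π / 2) ∧
          (e (Amalgam.inr i j (DihedralGroup.sr 0)) : SO3) = Rx (2 * π / m) ^ (m / 2)) ∧
    (4 ∣ m →
      HasPresentation (Ghat m 4) (Rx (2 * π / m)) (Ry (π / 2))
        {genA ^ m, genB ^ 4, (genA * genB ^ 2) ^ 2, (genA ^ (m / 2) * genB) ^ 2,
          (genA ^ (m / 4) * genB) ^ 3} ∧
      ∃ (i : DihedralGroup 4 →* DihedralGroup m) (j : DihedralGroup 4 →* Ghat 4 4),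
        Function.Injective i ∧ Function.Injective j ∧
        i (DihedralGroup.r 1) = DihedralGroup.r 1 ^ (m / 4) ∧
        i (DihedralGroup.sr 0) = DihedralGroup.sr 0 ∧
        (j (DihedralGroup.r 1) : SO3) = Rx (π / 2) ∧
        (j (DihedralGroup.sr 0) : SO3) = Ry (π / 2) ^ 2 ∧
        ∃ e : Amalgam i j ≃* Ghat m 4,
          (e (Amalgam.inl i j (DihedralGroup.r 1)) : SO3) = Rx (2 * π / m) ∧
          (e (Amalgam.inl i j (DihedralGroup.sr 0)) : SO3) = Ry (π / 2) ^ 2 ∧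
          ∀ g : Ghat 4 4, (e (Amalgam.inr i j g) : SO3) = g) :=
  ⟨Ghat_of_odd hm, fun ⟨_, ho, hmk⟩ => Ghat_of_two_mul_odd hm ho hmk, Ghat_of_four_dvd hm⟩
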